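/- Let $p$ be an odd prime and let $m,\ell$ be positive integers such that $m_\ell := m/\delta$ is even, where $\delta=\gcd(m,\ell)$, and $m>6\ell$. Put $\varepsilon=(-1)^{m_\ell/2}$, $n=p^m-1$, let $\mathrm{Tr}$ be the trace from $\mathbb F_{p^m}$ to $\mathbb F_p$, and let $\mathcal L=\langle x^{p^\ell},x^{p^{3\ell}}\rangle$ be the $\mathbb F_{p^m}$-linear span of $x^{p^\ell}$ and $x^{p^{3\ell}}$ in $\mathbb F_{p^m}[x]$. Consider the codes $$\mathcal C_{\mathcal L,0}=\{(\mathrm{Tr}(xR(x))+b)_{x\in\mathbb F_{p^m}^*}: R\in\mathcal L,\ b\in\mathbb F_p\},$$ $$\mathcal C_{\mathcal L,2}=\{(\mathrm{Tr}(xR(x)+\beta x)+b)_{x\in\mathbb F_{p^m}^*}: R\in\mathcal L,\ \beta\in\mathbb F_{p^m},\ b\in\mathbb F_p\}$$ over $\mathbb F_p$. Then $\mathcal C_{\mathcal L,0}$ is an $[n,2m+1,d]_p$-code (length, dimension, minimum Hamming distance) with $d=p^{m-1}(p-1)-d'$, where $d'=p^{\frac m2+3\delta-1}+1$ if $\frac12m_\ell$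 is even and $d'=(p-1)p^{\frac m2+3\delta-1}$ if $\frac12 m_\ell$ is odd; and $\mathcal C_{\mathcal L,2}$ is an $[n,3m+1,\hat d]_p$-code with $\hat d=d$ if $\frac12m_\ell$ is even and $\hat d=d-1$ if $\frac12 m_\ell$ is odd. Put $D=p^{6\delta}+p^{5\delta}-p^{4\delta}+p^{2\delta}-p^{\delta}-1$, $\Sigma=\sum_{j=0}^{5}(-1)^{j+1}p^{j\delta}$ and \begin{align*} D F_0&=p^{2m+6\delta}-p^{2m+4\delta}-p^{2m+\delta}+p^{m+4\delta}+p^{m+\delta}-p^{6\delta}+\varepsilon\big(p^{\frac{3m}2+5\delta}-p^{\frac{3m}2+4\delta}-p^{\frac m2+5\delta}+p^{\frac m2+4\delta}\big),\\ D F_1&=p^{2m-2\delta}(p^{7\delta}-p^{2\delta}-1)+p^{m-2\delta}(p^{5\delta}-p^{6\delta}+p^{2\delta}+1)-p^{3\delta}(p^{2\delta}-p^{\delta}+1)-\varepsilon\big(p^{\frac{3m}2}-p^{\frac m2}\big)\Sigma,\\ D F_2&=p^{2m-3\delta}(p^{5\delta}+p^{\delta}-1)-p^{m-3\delta}(p^{6\delta}+p^{4\delta}+p^{\delta}-1)+p^{\delta}(p^{2\delta}-p^{\delta}+1)+\varepsilon\big(p^{\frac{3m}2-2\delta}-p^{\frac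 m2-2\delta}\big)\Sigma,\\ D F_3&=p^{2m-3\delta}-p^{m}-p^{m-3\delta}+1-\varepsilon\big(p^{\frac{3m}2-\delta}-p^{\frac{3m}2-2\delta}-p^{\frac m2-\delta}+p^{\frac m2-2\delta}\big). \end{align*} For $0\le i\le 3$ put $\varepsilon_i=(-1)^i\varepsilon$, $r_i=m-2i\delta$ and $u_i=p^{\frac m2+i\delta-1}$, $v_i=p^{\frac{r_i}2-1}$. The weight distribution of $\mathcal C_{\mathcal L,0}$ is as follows, and no other weight occurs: weight $0$ with frequency $1$; weight $p^m-1$ with frequency $p-1$; and, for $i=0,1,2,3$, weight $p^m-p^{m-1}-\varepsilon_i(p-1)u_i$ with frequency $F_i$ and weight $p^m-p^{m-1}+\varepsilon_iu_i-1$ with frequency $(p-1)F_i$. The weight distribution of $\mathcal C_{\mathcal L,2}$ is as follows, and no other weight occurs: weight $0$ with frequency $1$; weight $p^m-1$ with frequency $p-1$; weight $p^m-p^{m-1}$ with frequency $A:=p^m-1+\sum_{i=0}^3F_i(p^m-p^{r_i})$; weight $p^m-p^{m-1}-1$ with frequency $(p-1)A$; and, for $i=0,1,2,3$, - weight $p^m-p^{m-1}-\varepsilon_i(p-1)u_i$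 with frequency $\big(p^{r_i-1}+\varepsilon_i(p-1)v_i\big)F_i$; - weight $p^m-p^{m-1}+\varepsilon_iu_i$ with frequency $\big(p^{r_i-1}-\varepsilon_iv_i\big)(p-1)F_i$; - weight $p^m-p^{m-1}-1-\varepsilon_i(p-1)u_i$ with frequency $\big(p^{r_i-1}-\varepsilon_iv_i\big)(p-1)F_i$; - weight $p^m-p^{m-1}-1+\varepsilon_iu_i$ with frequency $\big(p^{r_i}-p^{r_i-1}+\varepsilon_iv_i\big)(p-1)F_i$. -/

import Mathlib

open Polynomial

namespace TraceCode

section Coding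

variable {F ι : Type*} [Field F] [DecidableEq F] [Fintype ι]

/-- A linear code `C ⊆ F^ι` is an `[n, k, d]`-code: it has length `n`, dimension `k`, and `d` is the
minimum of the Hamming distances between distinct codewords. -/
structure IsCode (C : Submodule F (ι → F)) (n k d : ℕ) : Prop where
  length_eq : Fintype.card ι = n
  finrank_eq : Module.finrank F C = k
  isLeast_dist : IsLeast {e : ℕ | ∃ c ∈ C, ∃ c' ∈ C, c ≠ c' ∧ hammingDist c c' = e} d

/-- The number of codewords of `C` of Hamming weight `w`. -/
noncomputable def weightFreq (C : Submodule F (ι → F)) (w : ℤ) : ℕ :=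
  {c : ι → F | c ∈ C ∧ (hammingNorm c : ℤ) = w}.ncard

/-- The weight distribution of `C` is given by the table `T`, a list of rows `(weight, frequency)`:
each listed weight occurs with the listed frequency, and no other weight occurs. -/
def HasWeightDistribution (C : Submodule F (ι → F)) (T : List (ℤ × ℚ)) : Prop :=
  (∀ row ∈ T, (weightFreq C row.1 : ℚ) = row.2) ∧
    ∀ c ∈ C, ∃ row ∈ T, (hammingNorm c : ℤ) = row.1

end Coding

section Codes

variable (p : ℕ) [Fact p.Prime] {K : Type*} [Field K] [Algebra (ZMod p) K]

/-- The code `{ (Tr(x R(x)) + b)_{x ∈ Kˣ} : R ∈ L, b ∈ 𝔽_p }`. -/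
def code0 (L : Submodule K K[X]) : Submodule (ZMod p) (Kˣ → ZMod p) where
  carrier := {c | ∃ R ∈ L, ∃ b : ZMod p, c = fun x : Kˣ =>
    Algebra.trace (ZMod p) K ((x : K) * R.eval (x : K)) + b}
  zero_mem' := ⟨0, L.zero_mem, 0, by funext x; simp⟩
  add_mem' := by
    rintro _ _ ⟨R, hR, b, rfl⟩ ⟨S, hS, b', rfl⟩
    refine ⟨R + S, L.add_mem hR hS, b + b', ?_⟩
    funext x
    simp only [Pi.add_apply, eval_add, mul_add, map_add]
    ring
  smul_mem' := by
    rintro a _ ⟨R, hR, b, rfl⟩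
    refine ⟨algebraMap (ZMod p) K a • R, L.smul_mem _ hR, a * b, ?_⟩
    funext x
    have h : (x : K) * (algebraMap (ZMod p) K a • R).eval (x : K)
        = a • ((x : K) * R.eval (x : K)) := by
      rw [eval_smul, smul_eq_mul, Algebra.smul_def]
      ring
    rw [h, map_smul]
    simp only [Pi.smul_apply, smul_eq_mul, mul_add]

/-- The code `{ (Tr(x R(x) + β x) + b)_{x ∈ Kˣ} : R ∈ L, β ∈ K, b ∈ 𝔽_p }`. -/
def code2 (L : Submodule K K[X]) : Submodule (ZMod p) (Kˣ → ZMod p) where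
  carrier := {c | ∃ R ∈ L, ∃ β : K, ∃ b : ZMod p, c = fun x : Kˣ =>
    Algebra.trace (ZMod p) K ((x : K) * R.eval (x : K) + β * (x : K)) + b}
  zero_mem' := ⟨0, L.zero_mem, 0, 0, by funext x; simp⟩
  add_mem' := by
    rintro _ _ ⟨R, hR, β, b, rfl⟩ ⟨S, hS, β', b', rfl⟩
    refine ⟨R + S, L.add_mem hR hS, β + β', b + b', ?_⟩
    funext x
    simp only [Pi.add_apply, eval_add, mul_add, add_mul, map_add]
    ring
  smul_mem' := by
    rintro a _ ⟨R, hR, β, b, rfl⟩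
    refine ⟨algebraMap (ZMod p) K a • R, L.smul_mem _ hR, a • β, a * b, ?_⟩
    funext x
    have h : (x : K) * (algebraMap (ZMod p) K a • R).eval (x : K) + (a • β) * (x : K)
        = a • ((x : K) * R.eval (x : K) + β * (x : K)) := by
      rw [eval_smul, smul_eq_mul, Algebra.smul_def, Algebra.smul_def]
      ring
    rw [h, map_smul]
    simp only [Pi.smul_apply, smul_eq_mul, mul_add]

variable (K)

/-- The `K`-linear span of `x^{p^ℓ}` and `x^{p^{3ℓ}}` in `K[x]`. -/
noncomputable def linFamily (ℓ : ℕ) : Submodule K K[X] :=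
  Submodule.span K {X ^ p ^ ℓ, X ^ p ^ (3 * ℓ)}

end Codes

section Tables

/-! In the formulas below `δ = gcd(m, ℓ)`; they are used only for `m / δ` even and `m > 6ℓ > 0`, so
that `m` is even, `m ≥ 8δ`, and all divisions and subtractions in exponents are exact. -/

/-- The sign `ε_ℓ = (-1)^{m_ℓ / 2}`, where `m_ℓ = m / gcd(m, ℓ)`. -/
def eps (m ℓ : ℕ) : ℤ := (-1) ^ (m / m.gcd ℓ / 2)

/-- The common denominator of the frequencies `F₀, …, F₃`. -/
def freqDen (p : ℚ) (δ : ℕ) : ℚ :=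
  p ^ (6 * δ) + p ^ (5 * δ) - p ^ (4 * δ) + p ^ (2 * δ) - p ^ δ - 1

/-- `∑_{i=0}^{5} (-1)^{i+1} p^{iδ}` -/
def altSum (p : ℚ) (δ : ℕ) : ℚ := ∑ i ∈ Finset.range 6, (-1) ^ (i + 1) * p ^ (i * δ)

/-- `F₀`, with `e` the sign `ε_ℓ`. -/
def freq0 (p : ℚ) (m δ : ℕ) (e : ℚ) : ℚ :=
  (p ^ (2 * m + 6 * δ) - p ^ (2 * m + 4 * δ) - p ^ (2 * m + δ) + p ^ (m + 4 * δ) + p ^ (m + δ)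
      - p ^ (6 * δ)
      + e * (p ^ (3 * m / 2 + 5 * δ) - p ^ (3 * m / 2 + 4 * δ) - p ^ (m / 2 + 5 * δ)
        + p ^ (m / 2 + 4 * δ)))
    / freqDen p δ

/-- `F₁`, with `e` the sign `ε_ℓ`. -/
def freq1 (p : ℚ) (m δ : ℕ) (e : ℚ) : ℚ :=
  (p ^ (2 * m - 2 * δ) * (p ^ (7 * δ) - p ^ (2 * δ) - 1)
      + p ^ (m - 2 * δ) * (p ^ (5 * δ) - p ^ (6 * δ) + p ^ (2 * δ) + 1)
      - p ^ (3 * δ) * (p ^ (2 * δ) - p ^ δ + 1)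
      - e * (p ^ (3 * m / 2) - p ^ (m / 2)) * altSum p δ)
    / freqDen p δ

/-- `F₂`, with `e` the sign `ε_ℓ`. -/
def freq2 (p : ℚ) (m δ : ℕ) (e : ℚ) : ℚ :=
  (p ^ (2 * m - 3 * δ) * (p ^ (5 * δ) + p ^ δ - 1)
      - p ^ (m - 3 * δ) * (p ^ (6 * δ) + p ^ (4 * δ) + p ^ δ - 1)
      + p ^ δ * (p ^ (2 * δ) - p ^ δ + 1)
      + e * (p ^ (3 * m / 2 - 2 * δ) - p ^ (m / 2 - 2 * δ)) * altSum p δ)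
    / freqDen p δ

/-- `F₃`, with `e` the sign `ε_ℓ`. -/
def freq3 (p : ℚ) (m δ : ℕ) (e : ℚ) : ℚ :=
  (p ^ (2 * m - 3 * δ) - p ^ m - p ^ (m - 3 * δ) + 1
      - e * (p ^ (3 * m / 2 - δ) - p ^ (3 * m / 2 - 2 * δ) - p ^ (m / 2 - δ)
        + p ^ (m / 2 - 2 * δ)))
    / freqDen p δ

/-- The frequencies `F₀, F₁, F₂, F₃`. -/
def freq (p m ℓ : ℕ) : Fin 4 → ℚ :=
  ![freq0 p m (m.gcd ℓ) (eps m ℓ), freq1 p m (m.gcd ℓ) (eps m ℓ),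
    freq2 p m (m.gcd ℓ) (eps m ℓ), freq3 p m (m.gcd ℓ) (eps m ℓ)]

/-- The sign `(-1)^i ε_ℓ`. -/
def sgn (m ℓ : ℕ) (i : Fin 4) : ℤ := (-1) ^ (i : ℕ) * eps m ℓ

/-- The weight distribution of `code0` for the family `⟨x^{p^ℓ}, x^{p^{3ℓ}}⟩`: two single rows, and
two rows for each `i = 0, 1, 2, 3`. -/
def table0 (p m ℓ : ℕ) : List (ℤ × ℚ) :=
  [(0, 1), ((p : ℤ) ^ m - 1, (p : ℚ) - 1)] ++
  (List.finRange 4).flatMap fun i =>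
    [((p : ℤ) ^ m - (p : ℤ) ^ (m - 1)
        - sgn m ℓ i * ((p : ℤ) - 1) * (p : ℤ) ^ (m / 2 + i * m.gcd ℓ - 1),
      freq p m ℓ i),
     ((p : ℤ) ^ m - (p : ℤ) ^ (m - 1)
        + sgn m ℓ i * (p : ℤ) ^ (m / 2 + i * m.gcd ℓ - 1) - 1,
      ((p : ℚ) - 1) * freq p m ℓ i)]

/-- The weight distribution of `code2` for the family `⟨x^{p^ℓ}, x^{p^{3ℓ}}⟩`: four single rows, and
four rows for each `i = 0, 1, 2, 3`. -/
def table2 (p m ℓ : ℕ) : List (ℤ × ℚ) :=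
  [(0, 1), ((p : ℤ) ^ m - 1, (p : ℚ) - 1),
   ((p : ℤ) ^ m - (p : ℤ) ^ (m - 1),
     (p : ℚ) ^ m - 1
       + ∑ i : Fin 4, freq p m ℓ i * ((p : ℚ) ^ m - (p : ℚ) ^ (m - 2 * i * m.gcd ℓ))),
   ((p : ℤ) ^ m - (p : ℤ) ^ (m - 1) - 1,
     ((p : ℚ) - 1) * ((p : ℚ) ^ m - 1
       + ∑ i : Fin 4, freq p m ℓ i * ((p : ℚ) ^ m - (p : ℚ) ^ (m - 2 * i * m.gcd ℓ))))] ++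
  (List.finRange 4).flatMap fun i =>
    [((p : ℤ) ^ m - (p : ℤ) ^ (m - 1)
        - sgn m ℓ i * ((p : ℤ) - 1) * (p : ℤ) ^ (m / 2 + i * m.gcd ℓ - 1),
      ((p : ℚ) ^ (m - 2 * i * m.gcd ℓ - 1)
        + sgn m ℓ i * ((p : ℚ) - 1) * (p : ℚ) ^ (m / 2 - i * m.gcd ℓ - 1)) * freq p m ℓ i),
     ((p : ℤ) ^ m - (p : ℤ) ^ (m - 1)
        + sgn m ℓ i * (p : ℤ) ^ (m / 2 + i * m.gcd ℓ - 1),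
      ((p : ℚ) ^ (m - 2 * i * m.gcd ℓ - 1)
        - sgn m ℓ i * (p : ℚ) ^ (m / 2 - i * m.gcd ℓ - 1)) * ((p : ℚ) - 1) * freq p m ℓ i),
     ((p : ℤ) ^ m - (p : ℤ) ^ (m - 1) - 1
        - sgn m ℓ i * ((p : ℤ) - 1) * (p : ℤ) ^ (m / 2 + i * m.gcd ℓ - 1),
      ((p : ℚ) ^ (m - 2 * i * m.gcd ℓ - 1)
        - sgn m ℓ i * (p : ℚ) ^ (m / 2 - i * m.gcd ℓ - 1)) * ((p : ℚ) - 1) * freq p m ℓ i),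
     ((p : ℤ) ^ m - (p : ℤ) ^ (m - 1) - 1
        + sgn m ℓ i * (p : ℤ) ^ (m / 2 + i * m.gcd ℓ - 1),
      ((p : ℚ) ^ (m - 2 * i * m.gcd ℓ) - (p : ℚ) ^ (m - 2 * i * m.gcd ℓ - 1)
        + sgn m ℓ i * (p : ℚ) ^ (m / 2 - i * m.gcd ℓ - 1)) * ((p : ℚ) - 1) * freq p m ℓ i)]

end Tables

end TraceCode

/-!
For `u = (a, a')` let `Q_u(x) = Tr(x (a σ(x) + a' σ³(x)))`, where `σ` is the `p^ℓ`-Frobenius of `K`,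
and let `q = p^δ`. The weight of a codeword is read off from the number of zeros of `Q_u + φ + b`
for a linear form `φ`, and this depends only on the character sum `S = ∑ ψ(Q_u(x))`, the size of the
radical of `Q_u`, the position of `φ` relative to the image of the polar form, and `b`.

The radical is a vector space over the fixed field of `σ²`, which has `q²` elements, and it consists
of roots of a `σ²`-polynomial of degree `3`; so its dimension `i` over that field is at most `3`,
and `S² = |K| q^(2i)`. The elements `t` of the fixed field with `t σ(t) = 1` preserve `Q_u` and act
freely on the nonzero vectors, so `S ≡ 1` modulo `q + 1`. This determines the sign:
`S = (-q)^(n + i)` with `|K| = q^(2n)`.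

The first three power moments of `S` over all `u` are counts of common zeros of `∑ x_j σ(x_j)` and
`∑ x_j σ³(x_j)` in at most three variables, which reduce to points of a Hermitian curve. Together
with the total number of `u` they give four linear equations for the frequencies of `i = 0, …, 3`,
whose solution is `F_0, …, F_3`. The minimum distances come from the rows with `i = 3`, where `|S|`
is largest.
-/

namespace TraceCode

open Finset

section AdditiveMaps

variable {A B : Type*} [AddGroup A] [Fintype A] [AddGroup B] [Fintype B] [DecidableEq B]

lemma card_preimage (T : A →+ B) (P : B → Prop) [DecidablePred P] :
    #{x | P (T x)} = #{y | P y ∧ ∃ x, T x = y} * #{x | T x = 0} := by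
  rw [card_eq_sum_card_fiberwise (f := T) (t := {y | P y ∧ ∃ x, T x = y}) (by
    intro x hx
    simpa using hx), sum_const_nat]
  intro y hy
  obtain ⟨hPy, x, rfl⟩ := by simpa using hy
  rw [← AddMonoidHom.card_fiber_eq_of_mem_range T ⟨x, rfl⟩ T.range.zero_mem, filter_filter]
  congr 1
  ext x'
  simpa using fun h : T x' = T x => h ▸ hPy

end AdditiveMaps

section TwistedPolynomials

variable {K : Type*} [Field K]

/-- The value at `y` of the `τ`-polynomial `∑ i ≤ d, c i τ ^ i`. -/
def twistedEval (τ : K →+* K) (c : ℕ → K) (d : ℕ) (y : K) : K :=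
  ∑ i ∈ range (d + 1), c i * τ^[i] y

lemma twistedEval_mul_eq_sub (τ : K →+* K) (c : ℕ → K) (d : ℕ) {v : K}
    (hv : twistedEval τ c (d + 1) v = 0) (y : K) :
    twistedEval τ c (d + 1) (v * y) =
      twistedEval τ (fun i => -∑ j ∈ range (i + 1), c j * τ^[j] v) d (τ y - y) := by
  have parts := sum_range_by_parts (τ^[·] y) (fun i => c i * τ^[i] v) (d + 2)
  simp only [smul_eq_mul, show d + 2 - 1 = d + 1 from rfl] at parts
  unfold twistedEval at hv ⊢
  rw [hv, mul_zero, zero_sub, ← sum_neg_distrib] at parts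
  refine Eq.trans (sum_congr rfl fun i _ => ?_) (parts.trans (sum_congr rfl fun i _ => ?_))
  · rw [iterate_map_mul]
    ring
  · rw [iterate_map_sub, ← Function.iterate_succ_apply]
    ring

variable [Fintype K] [DecidableEq K]

/-- At a nonzero root the polynomial factors, after rescaling, through `τ - 1`; each factor
contributes at most `|Fix τ|` to the size of the kernel. -/
lemma card_twistedEval_eq_zero_le (τ : K →+* K) (d : ℕ) (c : ℕ → K) (hc : ∃ i ≤ d, c i ≠ 0) :
    #{y | twistedEval τ c d y = 0} ≤ #{y | τ y = y} ^ d := by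
  induction d generalizing c with
  | zero =>
    obtain ⟨i, hi, hci⟩ := hc
    obtain rfl := Nat.le_zero.1 hi
    simp [twistedEval, hci, filter_eq']
  | succ d ih =>
    have one_le_fix : 1 ≤ #{y | τ y = y} := card_pos.2 ⟨0, by simp⟩
    by_cases hroot : ∃ v ≠ 0, twistedEval τ c (d + 1) v = 0
    · obtain ⟨v, hv, hroot⟩ := hroot
      set b : ℕ → K := fun i => -∑ j ∈ range (i + 1), c j * τ^[j] v with hb
      have b_ne : ∃ i ≤ d, b i ≠ 0 := by
        by_contra! hb0
        obtain ⟨i, hi, hci⟩ := hc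
        have prefix_zero : ∀ k ≤ d + 2, ∑ j ∈ range k, c j * τ^[j] v = 0 := by
          rintro (_ | k) hk
          · simp
          · rcases Nat.lt_or_ge d k with h | h
            · obtain rfl : k = d + 1 := by lia
              exact hroot
            · exact neg_eq_zero.1 (hb0 k h)
        have hterm := prefix_zero (i + 1) (by lia)
        rw [sum_range_succ, prefix_zero i (by lia), zero_add, ← RingHom.coe_pow] at hterm
        exact hci ((mul_eq_zero.1 hterm).resolve_right ((_root_.map_ne_zero _).2 hv))
      have rescale : #{y | twistedEval τ c (d + 1) y = 0} =
          #{y | twistedEval τ b d (τ y - y) = 0} := by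
        simp only [hb, ← twistedEval_mul_eq_sub τ c d hroot]
        exact (card_equiv (Equiv.mulLeft₀ v hv) (by simp)).symm
      rw [rescale, pow_succ]
      refine (card_preimage (τ.toAddMonoidHom - AddMonoidHom.id K)
        (fun z => twistedEval τ b d z = 0)).trans_le (Nat.mul_le_mul ?_ ?_)
      · exact (card_le_card (monotone_filter_right _ fun _ _ h => h.1)).trans (ih b b_ne)
      · simp [sub_eq_zero]
    · push Not at hroot
      refine (card_le_one.2 fun x hx y hy => ?_).trans (Nat.one_le_pow _ _ one_le_fix)
      rw [mem_filter_univ] at hx hy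
      rw [not_imp_comm.1 (hroot x) (fun h => h hx), not_imp_comm.1 (hroot y) (fun h => h hy)]

end TwistedPolynomials

lemma card_pow_eq_of_pow_eq_one {G : Type*} [CommGroup G] [IsCyclic G] [Fintype G] [DecidableEq G]
    {d e : ℕ} (hG : Nat.card G = d * e) {c : G} (hc : c ^ e = 1) : #{t : G | t ^ d = c} = d := by
  have hde : 0 < d * e := hG ▸ Nat.card_pos
  have range_eq_ker : (powMonoidHom d : G →* G).range = (powMonoidHom e).ker := by
    refine Subgroup.eq_of_le_of_card_ge ?_ ?_
    · rintro _ ⟨t, rfl⟩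
      rw [MonoidHom.mem_ker, powMonoidHom_apply, powMonoidHom_apply, ← pow_mul, ← hG,
        pow_card_eq_one']
    · rw [IsCyclic.card_powMonoidHom_ker, IsCyclic.card_powMonoidHom_range, hG,
        Nat.gcd_mul_left_left, Nat.gcd_mul_right_left,
        Nat.mul_div_cancel_left _ (Nat.pos_of_mul_pos_right hde)]
  have c_mem : c ∈ (powMonoidHom d : G →* G).range := range_eq_ker ▸ hc
  calc #{t : G | t ^ d = c} = #{t : G | t ^ d = 1} :=
        MonoidHom.card_fiber_eq_of_mem_range (powMonoidHom d : G →* G) c_mem ⟨1, one_pow d⟩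
    _ = Nat.card (powMonoidHom d : G →* G).ker := by
        rw [← Nat.subtype_card]
        simp [MonoidHom.mem_ker]
    _ = d := by rw [IsCyclic.card_powMonoidHom_ker, hG, Nat.gcd_mul_right_left]

/-- `σ` is an automorphism of `K` such that the fixed field of `σ²` has `q²` elements and `σ` acts
on it as the `q`-power map; this is all that is needed of the Frobenius `x ↦ x ^ p ^ ℓ`, with
`q = p ^ gcd m ℓ`. -/
structure IsHermitianFrobenius {F K : Type*} [Field F] [Field K] [Fintype K] [DecidableEq K]
    [Algebra F K] (σ : K ≃ₐ[F] K) (q : ℕ) : Prop where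
  card_fix : #{x | σ (σ x) = x} = q ^ 2
  apply_of_fix : ∀ x, σ (σ x) = x → σ x = x ^ q

namespace IsHermitianFrobenius

variable {F K : Type*} [Field F] [Field K] [Fintype K] [DecidableEq K] [Algebra F K]
  {σ : K ≃ₐ[F] K} {q : ℕ}

lemma two_le (h : IsHermitianFrobenius σ q) : 2 ≤ q := by
  have two_le_card : 2 ≤ #{x | σ (σ x) = x} := by
    rw [← card_pair (zero_ne_one (α := K))]
    exact card_le_card (by simp [insert_subset_iff])
  by_contra! hq
  interval_cases q <;> simp [h.card_fix] at two_le_card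

lemma sq_eq (h : IsHermitianFrobenius σ q) : q ^ 2 = (q + 1) * (q - 1) + 1 := by
  obtain ⟨k, rfl⟩ := Nat.exists_eq_add_of_le' (one_le_two.trans h.two_le)
  rw [Nat.add_sub_cancel]
  ring

lemma card_norm_eq (h : IsHermitianFrobenius σ q) {c : K} (hc0 : c ≠ 0) (hc : σ c = c) :
    #{t | t * σ t = c ∧ σ (σ t) = t} = q + 1 := by
  classical
  let E : Subfield K := (σ.trans σ : K →+* K).eqLocusField (RingHom.id K)
  have mem_E (x : K) : x ∈ E ↔ σ (σ x) = x := Iff.rfl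
  have card_units : Nat.card Eˣ = (q + 1) * (q - 1) := by
    rw [Nat.card_units, Nat.card_eq_fintype_card,
      Fintype.card_of_subtype {x | σ (σ x) = x} (by simp [mem_E]), h.card_fix, h.sq_eq,
      Nat.add_sub_cancel]
  let u : Eˣ := Units.mk0 ⟨c, (mem_E c).2 (by rw [hc, hc])⟩ (by simpa [Subtype.ext_iff] using hc0)
  have pow_u : u ^ (q - 1) = 1 := by
    refine Units.ext (Subtype.ext (mul_right_cancel₀ hc0 ?_))
    rw [Units.val_one, Subfield.coe_one, one_mul, Units.val_pow_eq_pow_val, SubmonoidClass.coe_pow,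
      Units.val_mk0, ← pow_succ, Nat.sub_add_cancel (one_le_two.trans h.two_le),
      ← h.apply_of_fix c (by rw [hc, hc]), hc]
  rw [← card_pow_eq_of_pow_eq_one card_units pow_u]
  have norm_eq_pow (t : E) : (t : K) * σ t = (t : K) ^ (q + 1) := by
    rw [h.apply_of_fix t t.2, pow_succ']
  symm
  refine card_bij (fun t _ => ((t : E) : K)) ?_ ?_ ?_
  · intro t ht
    simp only [mem_filter_univ] at ht ⊢
    exact ⟨(norm_eq_pow t).trans (congrArg (fun s : Eˣ => ((s : E) : K)) ht), t.1.2⟩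
  · exact fun t _ t' _ htt => Units.ext (Subtype.ext htt)
  · intro t ht
    simp only [mem_filter_univ] at ht
    have ht0 : t ≠ 0 := fun h0 => hc0 (by rw [← ht.1, h0, zero_mul])
    refine ⟨Units.mk0 ⟨t, ht.2⟩ (by simpa [Subtype.ext_iff] using ht0), ?_, rfl⟩
    rw [mem_filter_univ]
    exact Units.ext (Subtype.ext ((norm_eq_pow ⟨t, ht.2⟩).symm.trans ht.1))

end IsHermitianFrobenius

lemma card_filter_fin_succ {α : Type*} [Fintype α] {k : ℕ} (P : (Fin (k + 1) → α) → Prop)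
    [DecidablePred P] :
    #{v | P v} = ∑ z, #{v : Fin k → α | P (Fin.cons z v)} := by
  simp only [card_filter]
  rw [← (Fin.consEquiv fun _ => α).sum_comp, Fintype.sum_prod_type]
  rfl

lemma sum_ite_eq_zero {α : Type*} [Fintype α] [DecidableEq α] [Zero α] (a b : ℕ) :
    ∑ y : α, (if y = 0 then a else b) = a + (Fintype.card α - 1) * b := by
  rw [sum_ite, filter_eq', if_pos (mem_univ _), filter_ne', sum_const, sum_const,
    card_singleton, card_erase_of_mem (mem_univ _), card_univ, one_smul, smul_eq_mul]

section CommonZeros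

variable {F K : Type*} [Field F] [Field K] [Fintype K] [DecidableEq K] [Algebra F K]

/-- The points `v` of `K ^ k` with `∑ i, v i * σ (v i) + c = 0` and `∑ i, v i * σ³ (v i) + c = 0`:
for `c = 0` the common zeros of the two forms, for `c = 1` those on an affine chart of one more
variable. -/
def commonZeros (σ : K ≃ₐ[F] K) (k : ℕ) (c : K) : Finset (Fin k → K) :=
  {v | ∑ i, v i * σ (v i) + c = 0 ∧ ∑ i, v i * σ (σ (σ (v i))) + c = 0}

lemma card_commonZeros_succ (σ : K ≃ₐ[F] K) (k : ℕ) :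
    #(commonZeros σ (k + 1) 0) =
      #(commonZeros σ k 0) + (Fintype.card K - 1) * #(commonZeros σ k 1) := by
  have fibre (z : K) : #{v : Fin k → K | (Fin.cons z v : Fin (k + 1) → K) ∈ commonZeros σ (k + 1) 0}
      = if z = 0 then #(commonZeros σ k 0) else #(commonZeros σ k 1) := by
    split_ifs with hz
    · subst hz
      simp [commonZeros, Fin.sum_univ_succ]
    · have hz1 : z * σ z ≠ 0 := mul_ne_zero hz ((map_ne_zero σ).2 hz)
      have hz3 : z * σ (σ (σ z)) ≠ 0 := mul_ne_zero hz (by simpa using hz)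
      symm
      refine card_equiv (Equiv.piCongrRight fun _ => Equiv.mulLeft₀ z hz) fun v => ?_
      have scale (τ : K →* K) :
          z * τ z + ∑ i, z * v i * τ (z * v i) = z * τ z * (∑ i, v i * τ (v i) + 1) := by
        simp only [map_mul, mul_add, mul_sum, mul_one, add_comm (z * τ z), mul_mul_mul_comm]
      have scale_one := scale σ
      have scale_three := scale ((σ.trans (σ.trans σ) : K ≃ₐ[F] K) : K →* K)
      simp only [MonoidHom.coe_coe, AlgEquiv.trans_apply] at scale_one scale_three
      simp only [commonZeros, mem_filter_univ, Fin.sum_univ_succ, Fin.cons_zero, Fin.cons_succ,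
        Equiv.piCongrRight_apply, Pi.map_apply, Equiv.mulLeft₀_apply, add_zero, scale_one,
        scale_three, mul_eq_zero_iff_left hz1, mul_eq_zero_iff_left hz3]
  calc #(commonZeros σ (k + 1) 0) = #{v | v ∈ commonZeros σ (k + 1) 0} := by simp
    _ = _ := by rw [card_filter_fin_succ, sum_congr rfl fun z _ => fibre z, sum_ite_eq_zero]

omit [Fintype K] [DecidableEq K] in
/-- Subtracting from each equation its image under `σ` or `σ²` gives a linear system for
`s - σ² s` and `t - σ² t`. -/
lemma fix_of_affine_zero {σ : K ≃ₐ[F] K} {s t : K} (h1 : s * σ s + t * σ t + 1 = 0)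
    (h3 : s * σ (σ (σ s)) + t * σ (σ (σ t)) + 1 = 0) : σ (σ s) = s ∧ σ (σ t) = t := by
  have h2 : σ s * σ (σ s) + σ t * σ (σ t) + 1 = 0 := by simpa using congrArg σ h1
  have h4 : σ (σ s) * σ (σ (σ s)) + σ (σ t) * σ (σ (σ t)) + 1 = 0 := by simpa using congrArg σ h2
  have e1 : σ s * (s - σ (σ s)) + σ t * (t - σ (σ t)) = 0 := by linear_combination h1 - h2
  have e2 : σ (σ (σ s)) * (s - σ (σ s)) + σ (σ (σ t)) * (t - σ (σ t)) = 0 := by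
    linear_combination h3 - h4
  by_cases hdet : σ s * σ (σ (σ t)) - σ t * σ (σ (σ s)) = 0
  · have hd : s * σ (σ t) - t * σ (σ s) = 0 := σ.injective (by simpa using hdet)
    constructor
    · linear_combination (-s) * h2 + σ (σ s) * h1 + σ t * hd
    · linear_combination (-t) * h2 + σ (σ t) * h1 - σ s * hd
  · have hs : (σ s * σ (σ (σ t)) - σ t * σ (σ (σ s))) * (s - σ (σ s)) = 0 := by
      linear_combination σ (σ (σ t)) * e1 - σ t * e2
    have ht : (σ s * σ (σ (σ t)) - σ t * σ (σ (σ s))) * (t - σ (σ t)) = 0 := by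
      linear_combination σ s * e2 - σ (σ (σ s)) * e1
    exact ⟨(sub_eq_zero.1 ((mul_eq_zero.1 hs).resolve_left hdet)).symm,
      (sub_eq_zero.1 ((mul_eq_zero.1 ht).resolve_left hdet)).symm⟩

lemma card_commonZeros_zero (σ : K ≃ₐ[F] K) : #(commonZeros σ 0 0) = 1 := by
  simp [commonZeros]

lemma card_commonZeros_one (σ : K ≃ₐ[F] K) : #(commonZeros σ 1 0) = 1 := by
  have affine : #(commonZeros σ 0 1) = 0 := by simp [commonZeros]
  rw [card_commonZeros_succ, card_commonZeros_zero, affine, mul_zero, add_zero]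

namespace IsHermitianFrobenius

variable {σ : K ≃ₐ[F] K} {q : ℕ}

lemma card_hermitian_points (h : IsHermitianFrobenius σ q) :
    #{v : K × K | (v.1 * σ v.1 + v.2 * σ v.2 + 1 = 0) ∧ σ (σ v.1) = v.1 ∧ σ (σ v.2) = v.2} =
      (q + 1) * (q ^ 2 - q) := by
  have fibre (s : K) : #{t | (s * σ s + t * σ t + 1 = 0) ∧ σ (σ s) = s ∧ σ (σ t) = t} =
      if σ (σ s) = s then if s * σ s = -1 then 1 else q + 1 else 0 := by
    split_ifs with hs hnorm
    · rw [card_eq_one]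
      refine ⟨0, ext fun t => ?_⟩
      simp +contextual [hs, hnorm]
    · rw [← h.card_norm_eq (c := -1 - s * σ s) (fun h0 => hnorm (by linear_combination -h0))
        (by simp only [map_sub, map_neg, map_one, map_mul, hs]; ring)]
      refine congrArg card (filter_congr fun t _ => ?_)
      simp only [hs, true_and, eq_sub_iff_add_eq, eq_neg_iff_add_eq_zero, add_comm (s * σ s)]
    · simp [hs]
  have card_norm : #{s | σ (σ s) = s ∧ s * σ s = -1} = q + 1 := by
    simpa only [and_comm] using h.card_norm_eq (neg_ne_zero.2 one_ne_zero) (by simp)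
  have card_not_norm : q ^ 2 - q = 1 + #{s | σ (σ s) = s ∧ ¬s * σ s = -1} := by
    have split := card_filter_add_card_filter_not (s := {s | σ (σ s) = s}) fun s => s * σ s = -1
    rw [filter_filter, filter_filter, h.card_fix, card_norm, add_assoc] at split
    rw [← split, Nat.add_sub_cancel_left]
  rw [card_filter, Fintype.sum_prod_type]
  simp only [card_filter] at fibre
  simp only [fibre, ← sum_filter, sum_ite, filter_filter, sum_const, smul_eq_mul,
    mul_one, card_norm, card_not_norm]
  ring

lemma card_commonZeros_one_one (h : IsHermitianFrobenius σ q) : #(commonZeros σ 1 1) = q + 1 := by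
  rw [← h.card_norm_eq (c := -1) (neg_ne_zero.2 one_ne_zero) (by simp)]
  refine card_equiv (Equiv.funUnique (Fin 1) K) fun v => ?_
  simp only [commonZeros, mem_filter_univ, univ_unique, Fin.default_eq_zero, sum_singleton,
    Equiv.funUnique_apply, ← add_eq_zero_iff_eq_neg]
  constructor
  · rintro ⟨h1, h3⟩
    exact ⟨h1, (fix_of_affine_zero (σ := σ) (t := 0) (by simpa using h1) (by simpa using h3)).1⟩
  · rintro ⟨h1, hfix⟩
    exact ⟨h1, by rwa [hfix]⟩

lemma card_commonZeros_two_one (h : IsHermitianFrobenius σ q) :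
    #(commonZeros σ 2 1) = (q + 1) * (q ^ 2 - q) := by
  rw [← h.card_hermitian_points]
  refine card_equiv (finTwoArrowEquiv K) fun v => ?_
  simp only [commonZeros, mem_filter_univ, Fin.sum_univ_two, finTwoArrowEquiv_apply]
  change _ ↔ _ ∧ σ (σ (v 0)) = v 0 ∧ σ (σ (v 1)) = v 1
  constructor
  · exact fun ⟨h1, h3⟩ => ⟨h1, fix_of_affine_zero h1 h3⟩
  · rintro ⟨h1, hs, ht⟩
    exact ⟨h1, by rwa [hs, ht]⟩

lemma card_commonZeros_two (h : IsHermitianFrobenius σ q) :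
    #(commonZeros σ 2 0) = 1 + (Fintype.card K - 1) * (q + 1) := by
  rw [card_commonZeros_succ, card_commonZeros_one, h.card_commonZeros_one_one]

lemma card_commonZeros_three (h : IsHermitianFrobenius σ q) :
    #(commonZeros σ 3 0) = 1 + (Fintype.card K - 1) * (q ^ 3 + 1) := by
  have hle : q ≤ q ^ 2 := Nat.le_self_pow two_ne_zero q
  rw [card_commonZeros_succ, h.card_commonZeros_two, h.card_commonZeros_two_one, add_assoc,
    ← mul_add]
  congr 2
  zify [hle]
  ring

end IsHermitianFrobenius

end CommonZeros

/-- The deviation of `|F| * #{x | g x = 0}` from `|V|`, the value it takes for an equidistributed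
function `g`. -/
def zeroExcess {F V : Type*} [Field F] [Fintype F] [DecidableEq F] [Fintype V] (g : V → F) : ℤ :=
  Fintype.card F * #{x | g x = 0} - Fintype.card V

section QuadraticForms

variable {F V : Type*} [Field F] [Fintype F] [DecidableEq F] [AddCommGroup V] [Module F V]
  [Fintype V]

/-- The number of vectors at which `Q` takes the value `c`. -/
def levelCard (Q : QuadraticForm F V) (c : F) : ℕ := #{x | Q x = c}

/-- `Q` is balanced if it takes all nonzero values equally often. -/
def IsBalanced (Q : QuadraticForm F V) : Prop := ∀ c ≠ 0, levelCard Q c = levelCard Q 1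

/-- The character sum of `Q`: for a balanced form it is the value of `∑ x, ψ (Q x)` for every
nontrivial additive character `ψ` of `F`. -/
def charSum (Q : QuadraticForm F V) : ℤ := levelCard Q 0 - levelCard Q 1

lemma sum_comp_eq_sum_levelCard {M : Type*} [AddCommMonoid M] (Q : QuadraticForm F V) (g : F → M) :
    ∑ x, g (Q x) = ∑ c, levelCard Q c • g c := by
  simp only [levelCard, ← sum_const]
  rw [← sum_fiberwise univ Q]
  exact sum_congr rfl fun c _ => sum_congr rfl fun x hx => by rw [(mem_filter_univ x).1 hx]

namespace IsBalanced

variable {Q : QuadraticForm F V}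

lemma card_eq (hQ : IsBalanced Q) :
    Fintype.card V = levelCard Q 0 + (Fintype.card F - 1) * levelCard Q 1 := by
  have count := sum_comp_eq_sum_levelCard Q fun _ => 1
  simp only [sum_const, smul_eq_mul, mul_one, card_univ] at count
  rw [count, ← sum_ite_eq_zero (α := F)]
  refine sum_congr rfl fun c _ => ?_
  split_ifs with hc
  · rw [hc]
  · exact hQ c hc

lemma card_mul_levelCard (hQ : IsBalanced Q) (c : F) :
    (Fintype.card F * levelCard Q c : ℤ) =
      Fintype.card V + (if c = 0 then (Fintype.card F : ℤ) - 1 else -1) * charSum Q := by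
  have hV := hQ.card_eq
  zify [Fintype.card_pos (α := F)] at hV
  rw [hV, charSum]
  split_ifs with hc
  · rw [hc]
    ring
  · rw [hQ c hc]
    ring

omit [Fintype F] in
lemma sum_addChar [Finite F] (hQ : IsBalanced Q) {ψ : AddChar F ℂ} (hψ : ψ ≠ 1) :
    ∑ x, ψ (Q x) = charSum Q := by
  have := Fintype.ofFinite F
  have compare (c : F) : (levelCard Q c : ℂ) * ψ c =
      levelCard Q 1 * ψ c + if c = 0 then (charSum Q : ℂ) else 0 := by
    split_ifs with hc
    · rw [hc, charSum, AddChar.map_zero_eq_one]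
      push_cast
      ring
    · rw [hQ c hc, add_zero]
  simp only [sum_comp_eq_sum_levelCard Q ψ, nsmul_eq_mul, compare]
  rw [sum_add_distrib, ← mul_sum, AddChar.sum_eq_zero_of_ne_one hψ, mul_zero, zero_add,
    Fintype.sum_ite_eq']

end IsBalanced

omit [Fintype F] [DecidableEq F] in
lemma sum_addChar_linear {ψ : AddChar F ℂ} (hψ : ψ ≠ 1) (φ : Module.Dual F V) [Decidable (φ = 0)] :
    ∑ x, ψ (φ x) = if φ = 0 then (Fintype.card V : ℂ) else 0 := by
  split_ifs with hφ
  · simp [hφ]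
  · refine AddChar.sum_eq_zero_of_ne_one (ψ := ψ.compAddMonoidHom φ.toAddMonoidHom)
      fun htriv => hψ ?_
    ext c
    obtain ⟨v, rfl⟩ := LinearMap.surjective hφ c
    exact DFunLike.congr_fun htriv v

/-- The excess of the quadratic polynomial `Q + φ + c`. -/
def excess (Q : QuadraticForm F V) (φ : Module.Dual F V) (c : F) : ℤ :=
  zeroExcess fun x => Q x + φ x + c

lemma IsBalanced.excess_polarBilin {Q : QuadraticForm F V} (hQ : IsBalanced Q) (y : V) (c : F) :
    excess Q (Q.polarBilin y) c =
      if Q y = c then ((Fintype.card F : ℤ) - 1) * charSum Q else -charSum Q := by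
  have complete : #{x | Q x + Q.polarBilin y x + c = 0} = levelCard Q (Q y - c) := by
    refine card_equiv (Equiv.addLeft y) fun x => ?_
    rw [mem_filter_univ, mem_filter_univ, Equiv.coe_addLeft, QuadraticMap.map_add Q,
      QuadraticMap.polarBilin_apply_apply, ← sub_eq_zero (b := Q y - c)]
    ring_nf
  rw [excess, zeroExcess, complete, hQ.card_mul_levelCard]
  simp only [sub_eq_zero]
  split_ifs <;> ring

lemma IsBalanced.excess_zero {Q : QuadraticForm F V} (hQ : IsBalanced Q) (c : F) :
    excess Q 0 c = (if c = 0 then (Fintype.card F : ℤ) - 1 else -1) * charSum Q := by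
  rw [← map_zero Q.polarBilin, hQ.excess_polarBilin, QuadraticMap.map_zero]
  simp only [eq_comm (a := (0 : F)), ite_mul, neg_one_mul]

variable [Invertible (2 : F)]

omit [Fintype F] [DecidableEq F] [Fintype V] in
lemma mem_range_polarBilin_iff [Finite V] (Q : QuadraticForm F V) (φ : Module.Dual F V) :
    (∃ y, Q.polarBilin y = φ) ↔ ∀ r ∈ Q.radical, φ r = 0 := by
  have flip_eq : Q.polarBilin.flip = Q.polarBilin :=
    LinearMap.ext₂ fun x y => QuadraticMap.polar_comm Q y x
  rw [← LinearMap.mem_range, ← flip_eq, ← LinearMap.dualAnnihilator_ker_eq_range_flip,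
    ← QuadraticMap.radical_eq_ker_polarBilin, Submodule.mem_dualAnnihilator]

lemma excess_eq_zero {Q : QuadraticForm F V} {φ : Module.Dual F V}
    (hφ : ¬∃ y, Q.polarBilin y = φ) (c : F) : excess Q φ c = 0 := by
  rw [mem_range_polarBilin_iff] at hφ
  push Not at hφ
  obtain ⟨r, hr, hφr⟩ := hφ
  have translate (a : F) : #{x | Q x + φ x + a = 0} = #{x | Q x + φ x + c = 0} := by
    refine card_equiv (Equiv.addLeft (((a - c) / φ r) • r)) fun x => ?_
    rw [mem_filter_univ, mem_filter_univ, Equiv.coe_addLeft, map_add φ, map_smul φ,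
      (QuadraticMap.mem_radical_iff'.1 (Q.radical.smul_mem _ hr)).2, smul_eq_mul,
      div_mul_cancel₀ _ hφr]
    ring_nf
  have total : Fintype.card V = Fintype.card F * #{x | Q x + φ x + c = 0} := by
    rw [← card_univ, card_eq_sum_card_fiberwise (f := fun x => -(Q x + φ x)) (t := univ) (by simp),
      sum_const_nat (m := #{x | Q x + φ x + c = 0}) fun a _ => ?_, card_univ]
    rw [← translate a]
    simp only [neg_eq_iff_add_eq_zero]
  rw [excess, zeroExcess, total]
  push_cast
  ring

lemma IsBalanced.excess_trichotomy {Q : QuadraticForm F V} (hQ : IsBalanced Q)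
    (φ : Module.Dual F V) (c : F) :
    excess Q φ c = ((Fintype.card F : ℤ) - 1) * charSum Q ∨ excess Q φ c = -charSum Q ∨
      excess Q φ c = 0 := by
  by_cases hφ : ∃ y, Q.polarBilin y = φ
  · obtain ⟨y, rfl⟩ := hφ
    rw [hQ.excess_polarBilin]
    split_ifs
    · exact .inl rfl
    · exact .inr (.inl rfl)
  · exact .inr (.inr (excess_eq_zero hφ c))

omit [Fintype F] in
/-- The square of the character sum is evaluated as `(∑ y, ψ (Q y)) * ∑ x, ψ (-Q x)`. -/
lemma IsBalanced.charSum_sq [Finite F] {Q : QuadraticForm F V} (hQ : IsBalanced Q) :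
    charSum Q ^ 2 = Fintype.card V * Nat.card Q.radical := by
  classical
  let ψ := AddChar.FiniteField.primitiveChar_to_Complex F
  have hψ : ψ ≠ 1 := by
    simpa using AddChar.FiniteField.primitiveChar_to_Complex_isPrimitive F one_ne_zero
  have hψ_inv : ψ⁻¹ ≠ 1 := inv_ne_one.2 hψ
  have inner_sum (z : V) : ∑ x, ψ (Q (x + z)) * ψ⁻¹ (Q x) =
      if z ∈ Q.radical then (Fintype.card V : ℂ) else 0 := by
    have expand (x : V) : ψ (Q (x + z)) * ψ⁻¹ (Q x) = ψ (Q z) * ψ (Q.polarBilin z x) := by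
      rw [AddChar.inv_apply, ← AddChar.map_add_eq_mul, ← AddChar.map_add_eq_mul,
        QuadraticMap.polarBilin_apply_apply, QuadraticMap.polar_comm, QuadraticMap.map_add Q]
      congr 1
      ring
    simp only [expand, ← mul_sum, sum_addChar_linear hψ]
    rw [QuadraticMap.radical_eq_ker_polarBilin, LinearMap.mem_ker]
    split_ifs with hz
    · rw [← LinearMap.mem_ker, ← QuadraticMap.radical_eq_ker_polarBilin] at hz
      rw [hz.1, AddChar.map_zero_eq_one, one_mul]
    · rw [mul_zero]
  have complex_eq : (charSum Q : ℂ) ^ 2 = Fintype.card V * Nat.card Q.radical := by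
    calc (charSum Q : ℂ) ^ 2 = (∑ y, ψ (Q y)) * ∑ x, ψ⁻¹ (Q x) := by
          rw [hQ.sum_addChar hψ, hQ.sum_addChar hψ_inv, sq]
      _ = ∑ x, ∑ z, ψ (Q (x + z)) * ψ⁻¹ (Q x) := by
          rw [sum_mul_sum, sum_comm]
          exact sum_congr rfl fun x _ =>
            (Equiv.sum_comp (Equiv.addLeft x) fun y => ψ (Q y) * ψ⁻¹ (Q x)).symm
      _ = ∑ z, if z ∈ Q.radical then (Fintype.card V : ℂ) else 0 := by
          rw [sum_comm, sum_congr rfl fun z _ => inner_sum z]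
      _ = Fintype.card V * Nat.card Q.radical := by
          rw [← sum_filter, sum_const, nsmul_eq_mul, mul_comm,
            Nat.subtype_card _ fun x => mem_filter_univ x]
  exact_mod_cast complex_eq

omit [Fintype F] in
lemma IsBalanced.charSum_ne_zero [Finite F] {Q : QuadraticForm F V} (hQ : IsBalanced Q) :
    charSum Q ≠ 0 := by
  intro h
  have hsq := hQ.charSum_sq
  simp [h, Fintype.card_ne_zero, Nat.card_pos.ne'] at hsq

section ExcessCounts

variable [Fintype (Module.Dual F V)] {Q : QuadraticForm F V}

omit [Fintype F] [DecidableEq F] in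
lemma card_polarBilin_filter_mul (P : Module.Dual F V → Prop) [DecidablePred P]
    (hP : ∀ φ, P φ → ∃ y, Q.polarBilin y = φ) :
    #{φ | P φ} * Nat.card Q.radical = #{y | P (Q.polarBilin y)} := by
  classical
  have card_radical : Nat.card Q.radical = #{y | Q.polarBilin y = 0} :=
    Nat.subtype_card _ fun y => by
      rw [mem_filter_univ, QuadraticMap.radical_eq_ker_polarBilin, LinearMap.mem_ker]
  rw [card_radical, filter_congr fun φ _ => (and_iff_left_of_imp (hP φ)).symm]
  exact (card_preimage Q.polarBilin.toAddMonoidHom P).symm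

lemma IsBalanced.card_excess_eq_mul (hQ : IsBalanced Q) (c : F) {v : ℤ} (hv : v ≠ 0) :
    #{φ | excess Q φ c = v} * Nat.card Q.radical =
      #{y | (if Q y = c then ((Fintype.card F : ℤ) - 1) * charSum Q else -charSum Q) = v} := by
  rw [card_polarBilin_filter_mul (fun φ => excess Q φ c = v) fun φ hφ =>
    not_imp_comm.1 (excess_eq_zero · c) (hφ.trans_ne hv)]
  simp only [hQ.excess_polarBilin]

lemma IsBalanced.card_excess_eq_top_mul (hQ : IsBalanced Q) (c : F) :
    #{φ | excess Q φ c = ((Fintype.card F : ℤ) - 1) * charSum Q} * Nat.card Q.radical =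
      levelCard Q c := by
  have hS := hQ.charSum_ne_zero
  have hF : (1 : ℤ) < Fintype.card F := mod_cast Fintype.one_lt_card
  rw [hQ.card_excess_eq_mul c (mul_ne_zero (by lia) hS), levelCard]
  refine congrArg card (filter_congr fun y _ => ?_)
  split_ifs with hy
  · simp [hy]
  · simp only [hy, iff_false]
    intro h
    exact mul_ne_zero (Nat.cast_ne_zero.2 Fintype.card_ne_zero) hS (by linear_combination -h)

lemma IsBalanced.card_excess_eq_neg_mul (hQ : IsBalanced Q) (c : F) :
    #{φ | excess Q φ c = -charSum Q} * Nat.card Q.radical + levelCard Q c = Fintype.card V := by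
  have hS := hQ.charSum_ne_zero
  rw [hQ.card_excess_eq_mul c (neg_ne_zero.2 hS), levelCard, add_comm]
  refine Eq.trans (congrArg _ (congrArg card (filter_congr fun y _ => ?_)))
    (card_filter_add_card_filter_not fun y => Q y = c)
  split_ifs with hy
  · simp only [hy, not_true_eq_false, iff_false]
    intro h
    exact mul_ne_zero (Nat.cast_ne_zero.2 Fintype.card_ne_zero) hS (by linear_combination h)
  · simp [hy]

lemma IsBalanced.card_excess_eq_zero_mul (hQ : IsBalanced Q) (c : F) :
    #{φ | excess Q φ c = 0} * Nat.card Q.radical + Fintype.card V =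
      Fintype.card V * Nat.card Q.radical := by
  have hS := hQ.charSum_ne_zero
  have hF : (1 : ℤ) < Fintype.card F := mod_cast Fintype.one_lt_card
  have card_dual : #(univ : Finset (Module.Dual F V)) = Fintype.card V := by
    rw [card_univ, Module.card_eq_pow_finrank (K := F), Subspace.dual_finrank_eq,
      ← Module.card_eq_pow_finrank]
  have nonzero : #{φ | ¬excess Q φ c = 0} * Nat.card Q.radical = Fintype.card V := by
    rw [card_polarBilin_filter_mul (fun φ => ¬excess Q φ c = 0) fun φ =>
      not_imp_comm.1 (excess_eq_zero · c), ← card_univ, filter_true_of_mem fun y _ => ?_]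
    rw [hQ.excess_polarBilin]
    split_ifs
    · exact mul_ne_zero (by lia) hS
    · exact neg_ne_zero.2 hS
  have split := card_filter_add_card_filter_not (s := univ) fun φ => excess Q φ c = 0
  rw [← nonzero, ← add_mul, split, card_dual, nonzero]

end ExcessCounts

end QuadraticForms

open scoped Pointwise in
lemma natCard_dvd_card_of_mul_mem {G : Type*} [Group G] (H : Subgroup G) (s : Finset G)
    (hs : ∀ x ∈ s, ∀ t ∈ H, x * t ∈ s) : Nat.card H ∣ #s := by
  have stable : (s : Set G) * (H : Set G) = s :=
    (Set.mul_subset_iff.2 hs).antisymm fun x hx => ⟨x, hx, 1, H.one_mem, mul_one x⟩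
  rw [← Set.ncard_coe_finset, ← Nat.card_coe_set_eq, ← stable,
    H.card_mul_eq_card_subgroup_mul_card_quotient]
  exact dvd_mul_right _ _

lemma card_filter_eq_card_units_add {K : Type*} [GroupWithZero K] [Fintype K] [DecidableEq K]
    (P : K → Prop) [DecidablePred P] :
    #{x | P x} = #{x : Kˣ | P x} + if P 0 then 1 else 0 := by
  have units_card : #{x : Kˣ | P x} = #{x : {x : K // x ≠ 0} | P x} :=
    card_equiv unitsEquivNeZero fun x => by simp
  rw [units_card, card_filter, card_filter, Fintype.sum_eq_add_sum_subtype_ne _ (0 : K), add_comm]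

lemma eq_neg_pow_of_sq {q : ℕ} {S : ℤ} {j : ℕ} (hq : 2 ≤ q) (hS : (q : ℤ) + 1 ∣ S - 1)
    (hsq : S ^ 2 = ((q : ℤ) ^ j) ^ 2) : S = (-(q : ℤ)) ^ j := by
  have pow_modEq : (q : ℤ) + 1 ∣ (-(q : ℤ)) ^ j - 1 := by
    refine dvd_trans ⟨-1, by ring⟩ (one_pow (M := ℤ) j ▸ sub_dvd_pow_sub_pow (-(q : ℤ)) 1 j)
  have sq_eq : S ^ 2 = ((-(q : ℤ)) ^ j) ^ 2 := by
    rw [hsq, ← pow_mul, mul_comm, pow_mul, ← neg_sq, ← pow_mul, mul_comm, pow_mul]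
  refine (sq_eq_sq_iff_eq_or_eq_neg.1 sq_eq).resolve_right fun hneg => ?_
  have two_dvd : (q : ℤ) + 1 ∣ 2 := by
    rw [hneg] at hS
    exact (dvd_neg.1 ((dvd_add hS pow_modEq).trans (dvd_of_eq (by ring))))
  have := Int.le_of_dvd two_pos two_dvd
  lia

section Family

variable {F K : Type*} [Field F] [Field K] [Algebra F K]

/-- The quadratic form `x ↦ Tr (x (a σ(x) + b σ³(x)))` attached to `u = (a, b)`. -/
noncomputable def traceQuadratic (σ : K ≃ₐ[F] K) (u : K × K) : QuadraticForm F K :=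
  LinearMap.BilinMap.toQuadraticMap ((Algebra.traceForm F K).compl₂
    (u.1 • σ.toLinearMap + u.2 • (σ.toLinearMap ∘ₗ σ.toLinearMap ∘ₗ σ.toLinearMap)))

lemma traceQuadratic_apply (σ : K ≃ₐ[F] K) (u : K × K) (x : K) :
    traceQuadratic σ u x = Algebra.trace F K (x * (u.1 * σ x + u.2 * σ (σ (σ x)))) := rfl

lemma polarBilin_traceQuadratic (σ : K ≃ₐ[F] K) (u : K × K) (y x : K) :
    (traceQuadratic σ u).polarBilin y x =
      Algebra.trace F K (y * (u.1 * σ x + u.2 * σ (σ (σ x)))) +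
        Algebra.trace F K (x * (u.1 * σ y + u.2 * σ (σ (σ y)))) :=
  LinearMap.BilinMap.polar_toQuadraticMap y x

lemma traceQuadratic_zero (σ : K ≃ₐ[F] K) : traceQuadratic σ 0 = 0 := by
  ext x
  simp [traceQuadratic_apply]

variable {σ : K ≃ₐ[F] K} {q n : ℕ}

lemma traceQuadratic_mul {t : K} (ht : σ (σ t) = t) {c : F} (hc : t * σ t = algebraMap F K c)
    (u : K × K) (x : K) : traceQuadratic σ u (t * x) = c * traceQuadratic σ u x := by
  rw [traceQuadratic_apply, traceQuadratic_apply, ← smul_eq_mul c, ← map_smul, Algebra.smul_def,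
    ← hc]
  simp only [map_mul, ht]
  ring_nf

lemma polarBilin_traceQuadratic_mul {e : K} (he : σ (σ e) = e) (u : K × K) (y x : K) :
    (traceQuadratic σ u).polarBilin (e * y) x = (traceQuadratic σ u).polarBilin y (σ e * x) := by
  simp only [polarBilin_traceQuadratic, ← map_add, map_mul, he]
  ring_nf

lemma polarBilin_traceQuadratic_eq_trace (u : K × K) (y x : K) :
    (traceQuadratic σ u).polarBilin y x =
      Algebra.trace F K (σ (σ (σ x)) * (u.2 * y + σ (σ u.1) * σ (σ y) +
        σ (σ (σ u.1)) * σ (σ (σ (σ y))) + σ (σ (σ u.2)) * σ (σ (σ (σ (σ (σ y))))))) := by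
  have trace_apply (x : K) : Algebra.trace F K (σ x) = Algebra.trace F K x :=
    Algebra.trace_eq_of_algEquiv σ x
  rw [polarBilin_traceQuadratic, mul_add, map_add, ← trace_apply (y * (u.1 * σ x)),
    ← trace_apply (σ (y * (u.1 * σ x))), ← trace_apply (x * (u.1 * σ y + _)),
    ← trace_apply (σ (x * (u.1 * σ y + _))), ← trace_apply (σ (σ (x * (u.1 * σ y + _))))]
  simp only [mul_add, map_add, map_mul]
  ring_nf

section Radical

variable [Fintype K]

lemma exists_natCard_radical_eq [DecidableEq K] [Invertible (2 : F)] (h : IsHermitianFrobenius σ q)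
    (u : K × K) : ∃ i : ℕ, Nat.card (traceQuadratic σ u).radical = q ^ (2 * i) := by
  let E : Subfield K := (σ.trans σ : K →+* K).eqLocusField (RingHom.id K)
  have card_E : Nat.card E = q ^ 2 := by
    rw [← h.card_fix]
    exact Nat.subtype_card _ fun x => mem_filter_univ x
  have mem_radical (y : K) : y ∈ (traceQuadratic σ u).radical ↔
      ∀ x, (traceQuadratic σ u).polarBilin y x = 0 := by
    rw [QuadraticMap.radical_eq_ker_polarBilin, LinearMap.mem_ker, LinearMap.ext_iff]
    rfl
  let radicalOverE : Submodule E K :=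
    { (traceQuadratic σ u).radical.toAddSubmonoid with
      smul_mem' := fun e y hy => (mem_radical _).2 fun x =>
        (polarBilin_traceQuadratic_mul e.2 u y x).trans ((mem_radical y).1 hy _) }
  refine ⟨Module.finrank E radicalOverE, ?_⟩
  rw [pow_mul, ← card_E]
  exact Module.natCard_eq_pow_finrank (K := E) (V := radicalOverE)

lemma natCard_radical_le [DecidableEq K] [Invertible (2 : F)]
    (h : IsHermitianFrobenius σ q) {u : K × K} (hu : u ≠ 0) :
    Nat.card (traceQuadratic σ u).radical ≤ q ^ (2 * 3) := by
  have : Finite F := .of_injective _ (algebraMap F K).injective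
  let τ : K →+* K := σ.trans σ
  let coeff : ℕ → K
    | 0 => u.2
    | 1 => σ (σ u.1)
    | 2 => σ (σ (σ u.1))
    | _ => σ (σ (σ u.2))
  have twistedEval_eq_zero {y : K} (hy : y ∈ (traceQuadratic σ u).radical) :
      twistedEval τ coeff 3 y = 0 := by
    rw [QuadraticMap.radical_eq_ker_polarBilin, LinearMap.mem_ker] at hy
    refine (traceForm_nondegenerate F K).2 _ fun w => ?_
    have hw := LinearMap.congr_fun hy (σ.symm (σ.symm (σ.symm w)))
    rw [polarBilin_traceQuadratic_eq_trace] at hw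
    simpa [twistedEval, sum_range_succ, coeff, τ] using hw
  calc Nat.card (traceQuadratic σ u).radical ≤ #{y | twistedEval τ coeff 3 y = 0} := by
        rw [← Nat.subtype_card {y | twistedEval τ coeff 3 y = 0} fun y => mem_filter_univ y]
        exact Nat.card_mono (Set.toFinite _) fun y hy => twistedEval_eq_zero hy
    _ ≤ #{y | τ y = y} ^ 3 := by
        refine card_twistedEval_eq_zero_le τ 3 coeff ?_
        by_contra! hcoeff
        exact hu (Prod.ext (by simpa [coeff] using hcoeff 1 (by lia)) (hcoeff 0 (by lia)))
    _ = q ^ (2 * 3) := by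
        rw [pow_mul, ← h.card_fix]
        rfl

end Radical

section CharSum

variable [Fintype F] [DecidableEq F] [Fintype K] [DecidableEq K]

omit [Fintype F] in
lemma isBalanced_traceQuadratic (h : IsHermitianFrobenius σ q) (u : K × K) :
    IsBalanced (traceQuadratic σ u) := by
  intro c hc
  have norm_fibre := h.card_norm_eq (c := algebraMap F K c) (by simpa using hc) (σ.commutes c)
  obtain ⟨t, ht⟩ := card_pos.1 (q.succ_pos.trans_eq norm_fibre.symm)
  rw [mem_filter_univ] at ht
  have ht0 : t ≠ 0 := by
    rintro rfl
    exact hc ((map_eq_zero (algebraMap F K)).1 (by simpa using ht.1.symm))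
  symm
  refine card_equiv (Equiv.mulLeft₀ t ht0) fun x => ?_
  simp [traceQuadratic_mul ht.2 ht.1, hc]

omit [Fintype F] in
/-- The elements of norm one act freely on the nonzero vectors of each level set. -/
lemma dvd_charSum_traceQuadratic_sub_one (h : IsHermitianFrobenius σ q) (u : K × K) :
    (q : ℤ) + 1 ∣ charSum (traceQuadratic σ u) - 1 := by
  let H : Subgroup Kˣ := (MonoidHom.id Kˣ * Units.map σ).ker
  have mem_H (t : Kˣ) : t ∈ H ↔ (t : K) * σ t = 1 := Units.ext_iff
  have fix_of_norm_one {t : K} (ht : t * σ t = 1) : σ (σ t) = t := by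
    refine mul_left_cancel₀ (right_ne_zero_of_mul_eq_one ht) ?_
    rw [← map_mul, ht, map_one, mul_comm, ht]
  have card_H : Nat.card H = q + 1 := by
    rw [Nat.subtype_card {t : Kˣ | (t : K) * σ t = 1} (by simp [mem_H]),
      ← h.card_norm_eq one_ne_zero (map_one σ), ← add_zero #{t : Kˣ | (t : K) * σ t = 1}]
    convert (card_filter_eq_card_units_add fun t : K => t * σ t = 1).symm using 2
    · simp
    · exact filter_congr fun t _ => and_iff_left_of_imp fix_of_norm_one
  have dvd_units (c : F) : q + 1 ∣ #{x : Kˣ | traceQuadratic σ u x = c} := by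
    rw [← card_H]
    refine natCard_dvd_card_of_mul_mem H _ fun x hx t ht => ?_
    rw [mem_H] at ht
    rw [mem_filter_univ] at hx ⊢
    rw [mul_comm, Units.val_mul, traceQuadratic_mul (fix_of_norm_one ht) (by rw [ht, map_one]),
      one_mul, hx]
  have key : charSum (traceQuadratic σ u) - 1 = (#{x : Kˣ | traceQuadratic σ u x = 0} : ℤ) -
      #{x : Kˣ | traceQuadratic σ u x = 1} := by
    rw [charSum, levelCard, levelCard, card_filter_eq_card_units_add,
      card_filter_eq_card_units_add fun x => traceQuadratic σ u x = 1]
    simp only [QuadraticMap.map_zero, if_true, zero_ne_one, if_false]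
    push_cast
    ring
  rw [key]
  exact_mod_cast dvd_sub (Int.natCast_dvd_natCast.2 (dvd_units 0))
    (Int.natCast_dvd_natCast.2 (dvd_units 1))

end CharSum

end Family

/-- The equations `∑ᵢ gᵢ (-Q)^(ik) = Mₖ` for `k = 0, 1, 2, 3`, which come from the power moments of
the numbers `Y (-Q)^i`, taken `gᵢ` times each, on dividing by `Y^k`. -/
structure SolvesMoments (Q Y : ℚ) (g : Fin 4 → ℚ) : Prop where
  zero : g 0 + g 1 + g 2 + g 3 = Y ^ 4 - 1
  one : g 0 - g 1 * Q + g 2 * Q ^ 2 - g 3 * Q ^ 3 = Y ^ 3 - Y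
  two : g 0 + g 1 * Q ^ 2 + g 2 * Q ^ 4 + g 3 * Q ^ 6 = Y ^ 2 * (Y ^ 2 - 1) * (Q + 1)
  three : g 0 - g 1 * Q ^ 3 + g 2 * Q ^ 6 - g 3 * Q ^ 9 = Y * (Y ^ 2 - 1) * Q ^ 3

namespace SolvesMoments

lemma three_mul {Q Y : ℚ} {g : Fin 4 → ℚ} (h : SolvesMoments Q Y g) :
    g 3 * (Q ^ 6 + Q ^ 5 - Q ^ 4 + Q ^ 2 - Q - 1) * Q ^ 3 =
      (Y ^ 2 - 1) * ((Y - Q ^ 2) * (Y + Q)) := by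
  linear_combination - h.three + (1 - Q + Q ^ 2) * h.two + (Q - Q ^ 2 + Q ^ 3) * h.one
    - Q ^ 3 * h.zero

variable {p e : ℚ} {δ w : ℕ} {g : Fin 4 → ℚ}

lemma eq_freq0 (h : SolvesMoments (p ^ δ) (e * p ^ w) g) (hD : freqDen p δ ≠ 0)
    (he : e = 1 ∨ e = -1) : g 0 = freq0 p (2 * w) δ e := by
  have half : 3 * (2 * w) / 2 = 3 * w := by lia
  obtain ⟨h0, h1, h2, h3⟩ := h
  rw [freq0, half, Nat.mul_div_cancel_left w two_pos, eq_div_iff hD, freqDen]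
  simp only [pow_add, pow_mul']
  generalize p ^ δ = Q at *
  rcases he with rfl | rfl <;>
  linear_combination Q ^ 6 * h0 + (Q ^ 3 - Q ^ 4 + Q ^ 5) * h1 - (Q - Q ^ 2 + Q ^ 3) * h2 - h3

variable (hp : p ≠ 0) (hw : 2 * δ ≤ w)
include hp hw

lemma eq_freq1 (h : SolvesMoments (p ^ δ) (e * p ^ w) g) (hD : freqDen p δ ≠ 0)
    (he : e = 1 ∨ e = -1) : g 1 = freq1 p (2 * w) δ e := by
  have half : 3 * (2 * w) / 2 = 3 * w := by lia
  obtain ⟨h0, h1, h2, h3⟩ := h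
  rw [freq1, half, Nat.mul_div_cancel_left w two_pos, eq_div_iff hD, freqDen, altSum,
    pow_sub₀ _ hp (by lia), pow_sub₀ _ hp (by lia)]
  simp only [pow_mul', sum_range_succ, sum_range_zero]
  have hQ : p ^ δ ≠ 0 := pow_ne_zero _ hp
  generalize p ^ δ = Q at *
  field_simp
  rcases he with rfl | rfl <;>
  linear_combination (Q ^ 2 - Q + 1) * (Q ^ 5 * h0 + (Q ^ 2 - Q ^ 3 - Q ^ 5) * h1
    - (1 + Q ^ 2 - Q ^ 3) * h2 + h3)

lemma eq_freq2 (h : SolvesMoments (p ^ δ) (e * p ^ w) g) (hD : freqDen p δ ≠ 0)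
    (he : e = 1 ∨ e = -1) : g 2 = freq2 p (2 * w) δ e := by
  have half : 3 * (2 * w) / 2 = 3 * w := by lia
  obtain ⟨h0, h1, h2, h3⟩ := h
  rw [freq2, half, Nat.mul_div_cancel_left w two_pos, eq_div_iff hD, freqDen, altSum,
    pow_sub₀ _ hp (by lia), pow_sub₀ _ hp (by lia), pow_sub₀ _ hp (by lia), pow_sub₀ _ hp hw]
  simp only [pow_mul', sum_range_succ, sum_range_zero]
  have hQ : p ^ δ ≠ 0 := pow_ne_zero _ hp
  generalize p ^ δ = Q at *
  field_simp
  rcases he with rfl | rfl <;>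
  linear_combination (Q ^ 2 - Q + 1) * (- Q ^ 4 * h0 + (Q ^ 4 - Q ^ 3 - Q) * h1
    + (Q ^ 3 + Q - 1) * h2 + h3)

lemma eq_freq3 (h : SolvesMoments (p ^ δ) (e * p ^ w) g) (hD : freqDen p δ ≠ 0)
    (he : e = 1 ∨ e = -1) : g 3 = freq3 p (2 * w) δ e := by
  have half : 3 * (2 * w) / 2 = 3 * w := by lia
  have h3 := h.three_mul
  rw [freq3, half, Nat.mul_div_cancel_left w two_pos, eq_div_iff hD, freqDen,
    pow_sub₀ _ hp (by lia), pow_sub₀ _ hp (by lia), pow_sub₀ _ hp (by lia),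
    pow_sub₀ _ hp (by lia), pow_sub₀ _ hp (by lia), pow_sub₀ _ hp hw]
  simp only [pow_mul']
  have hQ : p ^ δ ≠ 0 := pow_ne_zero _ hp
  generalize p ^ δ = Q at *
  field_simp
  rcases he with rfl | rfl <;> linear_combination h3

end SolvesMoments

lemma freqDen_pos {p : ℚ} (hp : 1 < p) {δ : ℕ} (hδ : δ ≠ 0) : 0 < freqDen p δ := by
  have hQ : 0 < p ^ δ - 1 := sub_pos.2 (one_lt_pow₀ hp hδ)
  have factored : freqDen p δ =
      (p ^ δ + 1) ^ 2 * ((p ^ δ - 1) * (p ^ δ + 1)) * (p ^ δ * (p ^ δ - 1) + 1) := by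
    rw [freqDen]
    ring
  rw [factored]
  positivity

lemma SolvesMoments.three_pos {Q Y : ℚ} {g : Fin 4 → ℚ} (h : SolvesMoments Q Y g) (hQ : 1 < Q)
    (hY : Q ^ 2 < |Y|) : 0 < g 3 := by
  have den_pos : 0 < Q ^ 6 + Q ^ 5 - Q ^ 4 + Q ^ 2 - Q - 1 := by
    simpa [freqDen] using freqDen_pos hQ one_ne_zero
  have cube_pos : 0 < Q ^ 3 := by positivity
  have first_pos : 0 < Y ^ 2 - 1 := by
    rw [sub_pos, one_lt_sq_iff_one_lt_abs]
    exact (one_lt_pow₀ hQ two_ne_zero).trans hY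
  have second_pos : 0 < (Y - Q ^ 2) * (Y + Q) := by
    rcases lt_abs.1 hY with hY | hY
    · exact mul_pos (by linarith) (by nlinarith)
    · exact mul_pos_of_neg_of_neg (by nlinarith) (by nlinarith)
  rw [← mul_pos_iff_of_pos_right den_pos, ← mul_pos_iff_of_pos_right cube_pos, h.three_mul]
  exact mul_pos first_pos second_pos

lemma SolvesMoments.eq_freq {p m ℓ : ℕ} {g : Fin 4 → ℚ} (hp : 1 < p) {w : ℕ} (hm : m = 2 * w)
    (hδ : m.gcd ℓ ≠ 0) (hw : 2 * m.gcd ℓ ≤ w)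
    (h : SolvesMoments ((p : ℚ) ^ m.gcd ℓ) (eps m ℓ * (p : ℚ) ^ w) g) : g = freq p m ℓ := by
  have hD : freqDen p (m.gcd ℓ) ≠ 0 := (freqDen_pos (by exact_mod_cast hp) hδ).ne'
  have hp0 : (p : ℚ) ≠ 0 := by positivity
  have he : (eps m ℓ : ℚ) = 1 ∨ (eps m ℓ : ℚ) = -1 := by
    simpa [eps] using neg_one_pow_eq_or ℚ (m / m.gcd ℓ / 2)
  unfold freq
  generalize m.gcd ℓ = δ at *
  generalize eps m ℓ = e at *
  subst hm
  ext i
  fin_cases i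
  · exact h.eq_freq0 hD he
  · exact h.eq_freq1 hp0 hw hD he
  · exact h.eq_freq2 hp0 hw hD he
  · exact h.eq_freq3 hp0 hw hD he

section CorankDistribution

variable {F K : Type*} [Field F] [DecidableEq F] [Invertible (2 : F)] [Field K]
  [Fintype K] [DecidableEq K] [Algebra F K] {σ : K ≃ₐ[F] K} {q n : ℕ}

lemma charSum_traceQuadratic (h : IsHermitianFrobenius σ q) (hK : Fintype.card K = q ^ (2 * n))
    {u : K × K} {i : ℕ} (hi : Nat.card (traceQuadratic σ u).radical = q ^ (2 * i)) :
    charSum (traceQuadratic σ u) = (-(q : ℤ)) ^ (n + i) := by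
  have : Finite F := .of_injective _ (algebraMap F K).injective
  refine eq_neg_pow_of_sq h.two_le (dvd_charSum_traceQuadratic_sub_one h u) ?_
  rw [(isBalanced_traceQuadratic h u).charSum_sq, hK, hi]
  push_cast
  ring

/-- The number of pairs `u` for which the radical of `traceQuadratic σ u` has dimension `i` over the
subfield fixed by `σ²`. -/
noncomputable def corankCount (σ : K ≃ₐ[F] K) (q i : ℕ) : ℕ :=
  #{u : K × K | Nat.card (traceQuadratic σ u).radical = q ^ (2 * i)}

omit [DecidableEq F] [DecidableEq K] in
lemma natCard_radical_traceQuadratic_zero (hK : Fintype.card K = q ^ (2 * n)) :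
    Nat.card (traceQuadratic σ 0).radical = q ^ (2 * n) := by
  have radical_zero : (traceQuadratic σ 0).radical = ⊤ := by
    rw [QuadraticMap.radical_eq_ker_polarBilin, LinearMap.ker_eq_top]
    refine LinearMap.ext₂ fun y x => ?_
    rw [polarBilin_traceQuadratic]
    simp
  rw [radical_zero, ← hK, ← Nat.card_eq_fintype_card]
  exact Nat.card_congr Submodule.topEquiv.toEquiv

omit [DecidableEq F] in
lemma exists_natCard_radical_eq_of_ne_zero (h : IsHermitianFrobenius σ q) {u : K × K}
    (hu : u ≠ 0) : ∃ i : Fin 4, Nat.card (traceQuadratic σ u).radical = q ^ (2 * (i : ℕ)) := by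
  obtain ⟨i, hi⟩ := exists_natCard_radical_eq h u
  have i_le : 2 * i ≤ 2 * 3 :=
    (Nat.pow_le_pow_iff_right h.two_le).1 (hi ▸ natCard_radical_le h hu)
  exact ⟨⟨i, by lia⟩, hi⟩

omit [DecidableEq F] in
lemma sum_eq_sum_corankCount (h : IsHermitianFrobenius σ q) (hK : Fintype.card K = q ^ (2 * n))
    (hn : 4 ≤ n) {R : Type*} [CommRing R] {G : K × K → R} {g : ℕ → R}
    (hG : ∀ u i, Nat.card (traceQuadratic σ u).radical = q ^ (2 * i) → G u = g i) :
    ∑ u, G u = g n + ∑ i : Fin 4, corankCount σ q i * g i := by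
  have hq := h.two_le
  have corank_unique {i j : ℕ} : q ^ (2 * i) = q ^ (2 * j) ↔ i = j := by
    rw [Nat.pow_right_inj hq]
    lia
  have zero_corank := natCard_radical_traceQuadratic_zero (σ := σ) hK
  have split (u : K × K) : G u = (if u = 0 then g n else 0) + ∑ i : Fin 4,
      if Nat.card (traceQuadratic σ u).radical = q ^ (2 * (i : ℕ)) then g i else 0 := by
    split_ifs with hu
    · subst hu
      rw [hG 0 n zero_corank, sum_eq_zero, add_zero]
      exact fun i _ => if_neg (by rw [zero_corank, corank_unique]; lia)
    · obtain ⟨i, hi⟩ := exists_natCard_radical_eq_of_ne_zero h hu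
      rw [hG u i hi, zero_add, sum_eq_single i _ (by simp), if_pos hi]
      exact fun j _ hj => if_neg fun h_eq => hj (Fin.ext (corank_unique.1 (h_eq.symm.trans hi)))
  simp only [split, sum_add_distrib, sum_ite_eq', mem_univ, if_true]
  rw [sum_comm]
  simp only [← sum_filter, sum_const, nsmul_eq_mul, corankCount]

omit [Invertible (2 : F)] in
lemma sum_charSum_pow (h : IsHermitianFrobenius σ q) (k : ℕ) :
    ∑ u : K × K, charSum (traceQuadratic σ u) ^ k =
      Fintype.card K ^ 2 * #(commonZeros σ k 0) := by
  classical
  have : Finite F := .of_injective _ (algebraMap F K).injective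
  let ψ := AddChar.FiniteField.primitiveChar_to_Complex F
  have hψ : ψ ≠ 1 := by
    simpa using AddChar.FiniteField.primitiveChar_to_Complex_isPrimitive F one_ne_zero
  let evalSum (v : Fin k → K) : Module.Dual F (K × K) :=
    LinearMap.coprodEquiv F (Algebra.traceForm F K (∑ i, v i * σ (v i)),
      Algebra.traceForm F K (∑ i, v i * σ (σ (σ (v i)))))
  have evalSum_apply (v : Fin k → K) (u : K × K) :
      evalSum v u = ∑ i, traceQuadratic σ u (v i) := by
    simp only [evalSum, LinearMap.coprodEquiv_apply, LinearMap.coprod_apply,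
      Algebra.traceForm_apply, traceQuadratic_apply, ← map_add, ← map_sum, sum_mul,
      ← sum_add_distrib]
    exact congrArg _ (sum_congr rfl fun i _ => by ring)
  have evalSum_eq_zero (v : Fin k → K) : evalSum v = 0 ↔ v ∈ commonZeros σ k 0 := by
    have trace_eq_zero (a : K) : Algebra.traceForm F K a = 0 ↔ a = 0 :=
      LinearMap.map_eq_zero_iff _ (LinearMap.ker_eq_bot.1
        (LinearMap.BilinForm.nondegenerate_iff_ker_eq_bot.1 (traceForm_nondegenerate F K)))
    rw [LinearEquiv.map_eq_zero_iff, Prod.mk_eq_zero, trace_eq_zero, trace_eq_zero]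
    simp [commonZeros]
  have expand (u : K × K) : (charSum (traceQuadratic σ u) : ℂ) ^ k = ∑ v, ψ (evalSum v u) := by
    rw [← (isBalanced_traceQuadratic h u).sum_addChar hψ, Fintype.sum_pow]
    refine sum_congr rfl fun v _ => ?_
    rw [evalSum_apply]
    exact (map_prod ψ.toMonoidHom (fun i => Multiplicative.ofAdd (traceQuadratic σ u (v i))) _).symm
  have complex_eq : ∑ u : K × K, (charSum (traceQuadratic σ u) : ℂ) ^ k =
      Fintype.card K ^ 2 * #(commonZeros σ k 0) := by
    simp only [expand]
    rw [sum_comm]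
    simp only [sum_addChar_linear hψ, evalSum_eq_zero, Fintype.card_prod]
    simp [sq, mul_comm]
  exact_mod_cast complex_eq

omit [DecidableEq F] in
lemma corankCount_moment (h : IsHermitianFrobenius σ q) (hK : Fintype.card K = q ^ (2 * n))
    (hn : 4 ≤ n) (k : ℕ) :
    ∑ i : Fin 4, (corankCount σ q i : ℤ) * ((-(q : ℤ)) ^ (n + i)) ^ k =
      Fintype.card K ^ 2 * #(commonZeros σ k 0) - ((-(q : ℤ)) ^ (n + n)) ^ k := by
  classical
  rw [← sum_charSum_pow h, sum_eq_sum_corankCount h hK hn (g := fun i => ((-(q : ℤ)) ^ (n + i)) ^ k)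
    fun u i hi => by rw [charSum_traceQuadratic h hK hi], add_sub_cancel_left]

omit [DecidableEq F] in
lemma solvesMoments_corankCount (h : IsHermitianFrobenius σ q)
    (hK : Fintype.card K = q ^ (2 * n)) (hn : 4 ≤ n) :
    SolvesMoments q ((-1) ^ n * q ^ n) fun i => corankCount σ q i := by
  have card_eq : (Fintype.card K : ℚ) = ((-1) ^ n * q ^ n) ^ 2 := by
    rw [mul_pow, ← pow_mul, ← pow_mul, mul_comm n, pow_mul, hK]
    simp
  have hY : (-1) ^ n * (q : ℚ) ^ n ≠ 0 := by
    have := h.two_le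
    positivity
  rw [← neg_pow] at card_eq hY ⊢
  let N : Fin 4 → ℚ := fun i => corankCount σ q i
  change SolvesMoments q _ N
  have moment (k : ℕ) : ∑ i : Fin 4, N i * ((-(q : ℚ)) ^ n * (-q) ^ (i : ℕ)) ^ k =
      ((-(q : ℚ)) ^ n) ^ 4 * #(commonZeros σ k 0) - (((-(q : ℚ)) ^ n) ^ 2) ^ k := by
    have := congrArg (Int.cast (R := ℚ)) (corankCount_moment h hK hn k)
    push_cast [pow_add, card_eq] at this
    rw [this]
    ring
  clear_value N
  generalize (-(q : ℚ)) ^ n = Y at *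
  have m0 := moment 0
  have m1 := moment 1
  have m2 := moment 2
  have m3 := moment 3
  rw [card_commonZeros_zero] at m0
  rw [card_commonZeros_one] at m1
  rw [h.card_commonZeros_two] at m2
  rw [h.card_commonZeros_three] at m3
  simp only [Fin.sum_univ_four, Fin.coe_ofNat_eq_mod, Nat.reduceMod] at m0 m1 m2 m3
  push_cast [Nat.cast_sub Fintype.card_pos, card_eq] at m0 m1 m2 m3
  exact ⟨by linear_combination m0, mul_left_cancel₀ hY (by linear_combination m1),
    mul_left_cancel₀ (pow_ne_zero 2 hY) (by linear_combination m2),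
    mul_left_cancel₀ (pow_ne_zero 3 hY) (by linear_combination m3)⟩

end CorankDistribution

section Words

variable {F K V : Type*} [Field F] [Fintype F] [DecidableEq F] [Field K] [Fintype K]
  [AddCommGroup V] [Module F V]

/-- The word `(f v x + c)` of values at the nonzero points `x` of `K` of the functions `f v + c`,
where `f` is a linear family of functions and `c` a constant. -/
def unitWord (f : V →ₗ[F] K → F) : V × F →ₗ[F] Kˣ → F :=
  LinearMap.funLeft F F Units.val ∘ₗ f.coprod (LinearMap.pi fun _ => LinearMap.id)

omit [Fintype F] [DecidableEq F] [Fintype K] in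
lemma unitWord_apply (f : V →ₗ[F] K → F) (v : V) (c : F) (x : Kˣ) :
    unitWord f (v, c) x = f v x + c := by
  simp [unitWord, LinearMap.funLeft_apply]

/-- `|F|` times the weight of the word of values `(g x + c)` at the nonzero points `x` of `K`, where
`g 0 = 0` and `e` is the excess of `g + c`. -/
def scaledWeight (K : Type*) [Fintype K] (e : ℤ) (c : F) : ℤ :=
  (Fintype.card F - 1) * Fintype.card K - e - if c = 0 then 0 else (Fintype.card F : ℤ)

variable [DecidableEq K] {f : V →ₗ[F] K → F}

lemma card_mul_hammingNorm_unitWord (hf : ∀ v, f v 0 = 0) (v : V) (c : F) :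
    (Fintype.card F * hammingNorm (unitWord f (v, c)) : ℤ) =
      scaledWeight K (zeroExcess fun x => f v x + c) c := by
  have zeros := card_filter_eq_card_units_add fun x => f v x + c = 0
  have units := card_filter_add_card_filter_not (s := univ) fun x : Kˣ => f v x + c = 0
  have norm_eq : hammingNorm (unitWord f (v, c)) = #{x : Kˣ | ¬f v x + c = 0} := by
    simp only [hammingNorm, unitWord_apply, ne_eq]
  simp only [hf, zero_add] at zeros
  rw [card_univ, Fintype.card_units, ← norm_eq] at units
  have card_K : Fintype.card K =
      #{x : Kˣ | f v x + c = 0} + hammingNorm (unitWord f (v, c)) + 1 := by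
    rw [units, Nat.sub_add_cancel Fintype.card_pos]
  rw [scaledWeight, zeroExcess, zeros, card_K]
  split_ifs <;> push_cast <;> ring

variable (hf : ∀ v, f v 0 = 0)
  (hdvd : ∀ v c, (Fintype.card F : ℤ) ^ 2 ∣ zeroExcess fun x => f v x + c)
include hf hdvd

/-- The terms `e` of scaled weights are divisible by `|F|²`, while the terms depending on `c` are
`0` and `-|F|`, so a scaled weight determines both. -/
lemma hammingNorm_unitWord_eq_iff {e w : ℤ} {c₀ : F} (he : (Fintype.card F : ℤ) ^ 2 ∣ e)
    (hw : Fintype.card F * w = scaledWeight K e c₀) (v : V) (c : F) :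
    (hammingNorm (unitWord f (v, c)) : ℤ) = w ↔
      (zeroExcess fun x => f v x + c) = e ∧ (c = 0 ↔ c₀ = 0) := by
  have hF : (1 : ℤ) < Fintype.card F := mod_cast Fintype.one_lt_card
  have not_dvd : ¬(Fintype.card F : ℤ) ^ 2 ∣ Fintype.card F := fun h => by
    have := Int.le_of_dvd (by lia) h
    nlinarith
  have norm := card_mul_hammingNorm_unitWord hf v c
  have hdiff := dvd_sub (hdvd v c) he
  rw [← mul_right_inj' (by lia : (Fintype.card F : ℤ) ≠ 0), hw, norm, scaledWeight, scaledWeight]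
  constructor
  · intro h
    split_ifs at h with hc hc₀ hc₀
    · exact ⟨by lia, by simp [hc, hc₀]⟩
    · exact absurd (hdiff.trans (dvd_of_eq (by linear_combination -h))) not_dvd
    · exact absurd ((dvd_neg.2 hdiff).trans (dvd_of_eq (by linear_combination h))) not_dvd
    · exact ⟨by lia, by simp [hc, hc₀]⟩
  · rintro ⟨h, hc⟩
    simp only [h, hc]

omit [DecidableEq K] in
lemma unitWord_injective (hK : (Fintype.card F : ℤ) ^ 2 ∣ Fintype.card K)
    (hinj : Function.Injective f) : Function.Injective (unitWord f) := by
  classical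
  rw [injective_iff_map_eq_zero]
  rintro ⟨v, c⟩ h
  have zero_weight : (Fintype.card F : ℤ) * 0 =
      scaledWeight K ((Fintype.card F - 1) * Fintype.card K) (0 : F) := by simp [scaledWeight]
  obtain ⟨-, hc⟩ := (hammingNorm_unitWord_eq_iff hf hdvd (hK.mul_left _) zero_weight v c).1
    (by simp [h])
  obtain rfl := hc.2 rfl
  refine Prod.ext_iff.2 ⟨(map_eq_zero_iff f hinj).1 (funext fun x => ?_), rfl⟩
  rcases eq_or_ne x 0 with rfl | hx
  · exact hf v
  · simpa [unitWord_apply] using congrFun h (Units.mk0 x hx)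

omit [Field K] [DecidableEq K] hf hdvd in
lemma card_zeroExcess_eq [Fintype V] (e : ℤ) {c c₀ : F} (hc : c = 0 ↔ c₀ = 0) :
    #{v | (zeroExcess fun x => f v x + c) = e} = #{v | (zeroExcess fun x => f v x + c₀) = e} := by
  rcases eq_or_ne c 0 with rfl | hc0
  · rw [hc.1 rfl]
  have hc₀0 := hc.not.1 hc0
  refine card_equiv (LinearEquiv.smulOfNeZero F V (c₀ / c) (div_ne_zero hc₀0 hc0)).toEquiv
    fun v => ?_
  have zeros : #{x | f ((c₀ / c) • v) x + c₀ = 0} = #{x | f v x + c = 0} := by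
    have scale (x : K) : f ((c₀ / c) • v) x + c₀ = c₀ / c * (f v x + c) := by
      rw [map_smul, Pi.smul_apply, smul_eq_mul, mul_add, div_mul_cancel₀ _ hc0]
    simp only [scale, mul_eq_zero, div_ne_zero hc₀0 hc0, false_or]
  rw [mem_filter_univ, mem_filter_univ]
  change _ ↔ zeroExcess (fun x => f ((c₀ / c) • v) x + c₀) = e
  rw [zeroExcess, zeroExcess, zeros]

lemma weightFreq_range_unitWord [Fintype V] (hinj : Function.Injective (unitWord f)) {e w : ℤ}
    {c₀ : F} (he : (Fintype.card F : ℤ) ^ 2 ∣ e) (hw : Fintype.card F * w = scaledWeight K e c₀) :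
    (weightFreq (LinearMap.range (unitWord f)) w : ℚ) =
      (if c₀ = 0 then 1 else (Fintype.card F : ℚ) - 1) *
        #{v | (zeroExcess fun x => f v x + c₀) = e} := by
  have codewords : {a | a ∈ LinearMap.range (unitWord f) ∧ (hammingNorm a : ℤ) = w} =
      unitWord f '' {z | (zeroExcess fun x => f z.1 x + z.2) = e ∧ (z.2 = 0 ↔ c₀ = 0)} := by
    ext a
    constructor
    · rintro ⟨⟨z, rfl⟩, hz⟩
      exact ⟨z, (hammingNorm_unitWord_eq_iff hf hdvd he hw z.1 z.2).1 hz, rfl⟩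
    · rintro ⟨z, hz, rfl⟩
      exact ⟨⟨z, rfl⟩, (hammingNorm_unitWord_eq_iff hf hdvd he hw z.1 z.2).2 hz⟩
  have card_constants : (#{c : F | c = 0 ↔ c₀ = 0} : ℚ) =
      if c₀ = 0 then 1 else (Fintype.card F : ℚ) - 1 := by
    split_ifs with h
    · simp [h, filter_eq']
    · simp [h, filter_ne', Nat.cast_sub Fintype.card_pos]
  rw [weightFreq, codewords, Set.ncard_image_of_injective _ hinj, ← card_constants,
    ← Nat.cast_mul, ← smul_eq_mul, ← sum_const, sum_filter, Set.ncard_eq_toFinset_card',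
    Set.toFinset_ofPred, card_filter, Fintype.sum_prod_type_right]
  refine congrArg _ (sum_congr rfl fun c _ => ?_)
  split_ifs with hc
  · simp only [hc, and_true]
    rw [← card_filter, card_zeroExcess_eq e hc]
  · simp [hc]

/-- The pair `row` of a weight and its frequency counts the words `unitWord f (v, c)` for which
`f v + c` has a certain excess and `c` is zero, respectively nonzero. -/
def IsWeightRow [Fintype V] (f : V →ₗ[F] K → F) (row : ℤ × ℚ) : Prop :=
  ∃ (e : ℤ) (c : F), (Fintype.card F : ℤ) ^ 2 ∣ e ∧
    Fintype.card F * row.1 = scaledWeight K e c ∧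
    (if c = 0 then 1 else (Fintype.card F : ℚ) - 1) * #{v | (zeroExcess fun x => f v x + c) = e} =
      row.2

lemma hasWeightDistribution_range_unitWord [Fintype V] (hinj : Function.Injective (unitWord f))
    {T : List (ℤ × ℚ)} (hT : ∀ row ∈ T, IsWeightRow f row)
    (hocc : ∀ v c, ∃ row ∈ T,
      Fintype.card F * row.1 = scaledWeight K (zeroExcess fun x => f v x + c) c) :
    HasWeightDistribution (LinearMap.range (unitWord f)) T := by
  refine ⟨fun row hrow => ?_, ?_⟩
  · obtain ⟨e, c₀, he, hw, hfreq⟩ := hT row hrow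
    rw [weightFreq_range_unitWord hf hdvd hinj he hw, hfreq]
  · rintro _ ⟨⟨v, c⟩, rfl⟩
    obtain ⟨row, hrow, hw⟩ := hocc v c
    exact ⟨row, hrow, (hammingNorm_unitWord_eq_iff hf hdvd (hdvd v c) hw v c).2 ⟨rfl, Iff.rfl⟩⟩

end Words

lemma three_le_card (F : Type*) [Field F] [Fintype F] [Invertible (2 : F)] :
    3 ≤ Fintype.card F := by
  have ne_two : Fintype.card F ≠ 2 := fun h =>
    (isUnit_of_invertible (2 : F)).ne_zero (by simpa [h] using Nat.cast_card_eq_zero F)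
  have := Fintype.one_lt_card (α := F)
  lia

lemma sub_one_mul_neg_pow_ne {r q : ℕ} (hr : 3 ≤ r) (hrq : r ≤ q) (a b : ℕ) :
    ((r : ℤ) - 1) * (-(q : ℤ)) ^ a ≠ -(-(q : ℤ)) ^ b := by
  intro h
  have abs_eq : ((r : ℤ) - 1) * q ^ a = q ^ b := by
    have := congrArg abs h
    rwa [abs_neg, abs_mul, abs_pow, abs_pow, abs_neg, Nat.abs_cast, abs_of_nonneg (by lia)] at this
  have q_pow_pos : (0 : ℤ) < (q : ℤ) ^ a := by
    have : 0 < q := by lia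
    positivity
  rcases le_or_gt b a with hba | hab
  · have := pow_le_pow_right₀ (by lia : (1 : ℤ) ≤ q) hba
    nlinarith
  · have := pow_le_pow_right₀ (by lia : (1 : ℤ) ≤ q) (Nat.succ_le_of_lt hab)
    rw [Nat.succ_eq_add_one, pow_succ] at this
    nlinarith

lemma sq_dvd_neg_pow {r q : ℕ} (hrq : r ∣ q) {k : ℕ} (hk : 2 ≤ k) :
    (r : ℤ) ^ 2 ∣ (-(q : ℤ)) ^ k :=
  (pow_dvd_pow_of_dvd (dvd_neg.2 (Int.natCast_dvd_natCast.2 hrq)) 2).trans (pow_dvd_pow _ hk)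

section ExcessDistribution

variable {F K : Type*} [Field F] [Fintype F] [DecidableEq F] [Invertible (2 : F)] [Field K]
  [Fintype K] [DecidableEq K] [Algebra F K] {σ : K ≃ₐ[F] K} {q n : ℕ}

section

variable (h : IsHermitianFrobenius σ q) (hK : Fintype.card K = q ^ (2 * n))
include h hK

omit [Fintype F] in
lemma charSum_traceQuadratic_eq_iff (u : K × K) (j : ℕ) :
    charSum (traceQuadratic σ u) = (-(q : ℤ)) ^ (n + j) ↔
      Nat.card (traceQuadratic σ u).radical = q ^ (2 * j) := by
  refine ⟨fun hS => ?_, charSum_traceQuadratic h hK⟩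
  obtain ⟨i, hi⟩ := exists_natCard_radical_eq h u
  rw [charSum_traceQuadratic h hK hi] at hS
  have := Int.pow_right_injective (by simpa using Nat.lt_of_succ_le h.two_le) hS
  rw [hi, add_left_cancel this]

lemma dvd_excess_traceQuadratic (hFq : Fintype.card F ∣ q) (hn : 2 ≤ n) (u : K × K)
    (φ : Module.Dual F K) (c : F) :
    (Fintype.card F : ℤ) ^ 2 ∣ excess (traceQuadratic σ u) φ c := by
  obtain ⟨i, hi⟩ := exists_natCard_radical_eq h u
  have dvd_charSum : (Fintype.card F : ℤ) ^ 2 ∣ charSum (traceQuadratic σ u) := by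
    rw [charSum_traceQuadratic h hK hi]
    exact sq_dvd_neg_pow hFq (by lia)
  rcases (isBalanced_traceQuadratic h u).excess_trichotomy φ c with he | he | he <;> rw [he]
  · exact dvd_charSum.mul_left _
  · exact dvd_charSum.neg_right
  · exact dvd_zero _

lemma card_excess_zero_traceQuadratic (c : F) (j : ℕ) :
    #{u | excess (traceQuadratic σ u) 0 c =
      (if c = 0 then (Fintype.card F : ℤ) - 1 else -1) * (-(q : ℤ)) ^ (n + j)} =
      corankCount σ q j := by
  have hF : (1 : ℤ) < Fintype.card F := mod_cast Fintype.one_lt_card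
  have coeff_ne_zero : (if c = 0 then (Fintype.card F : ℤ) - 1 else -1) ≠ 0 := by
    split_ifs <;> lia
  refine congrArg card (filter_congr fun u _ => ?_)
  rw [(isBalanced_traceQuadratic h u).excess_zero, mul_right_inj' coeff_ne_zero,
    charSum_traceQuadratic_eq_iff h hK]

variable [Fintype (Module.Dual F K)]

omit [Fintype F] [DecidableEq F] [Invertible (2 : F)] [DecidableEq K] h hK in
lemma card_filter_mul_eq_corankCount_mul {P : K × K → Module.Dual F K → Prop}
    [∀ u φ, Decidable (P u φ)] {j : ℕ} {A N : ℤ}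
    (hcorank : ∀ u φ, P u φ → Nat.card (traceQuadratic σ u).radical = q ^ (2 * j))
    (hN : ∀ u, Nat.card (traceQuadratic σ u).radical = q ^ (2 * j) → #{φ | P u φ} * A = N) :
    #{z : (K × K) × Module.Dual F K | P z.1 z.2} * A = corankCount σ q j * N := by
  rw [card_filter, Fintype.sum_prod_type, Nat.cast_sum, sum_mul, corankCount, ← nsmul_eq_mul,
    ← sum_const, sum_filter]
  refine sum_congr rfl fun u _ => ?_
  rw [← card_filter]
  split_ifs with hu
  · exact hN u hu
  · rw [filter_false_of_mem fun φ _ hφ => hu (hcorank u φ hφ), card_empty, Nat.cast_zero, zero_mul]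

lemma card_excess_top (hFq : Fintype.card F ∣ q) (c : F) (j : ℕ) :
    (#{z : (K × K) × Module.Dual F K | excess (traceQuadratic σ z.1) z.2 c =
      ((Fintype.card F : ℤ) - 1) * (-(q : ℤ)) ^ (n + j)} * (Fintype.card F * q ^ (2 * j)) : ℤ) =
      corankCount σ q j * (q ^ (2 * n) +
        (if c = 0 then (Fintype.card F : ℤ) - 1 else -1) * (-(q : ℤ)) ^ (n + j)) := by
  have hF := three_le_card F
  have hF_le := Nat.le_of_dvd (zero_lt_two.trans_le h.two_le) hFq
  have hF1 : (Fintype.card F : ℤ) - 1 ≠ 0 := by lia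
  refine card_filter_mul_eq_corankCount_mul (P := fun u φ => excess (traceQuadratic σ u) φ c = _)
    (fun u φ he => ?_) fun u hu => ?_
  · obtain ⟨i, hi⟩ := exists_natCard_radical_eq h u
    rcases (isBalanced_traceQuadratic h u).excess_trichotomy φ c with h' | h' | h' <;> rw [h'] at he
    · exact (charSum_traceQuadratic_eq_iff h hK u j).1 (mul_left_cancel₀ hF1 he)
    · rw [charSum_traceQuadratic h hK hi] at he
      exact absurd he.symm (sub_one_mul_neg_pow_ne hF hF_le _ _)
    · exact absurd he.symm (mul_ne_zero hF1 (pow_ne_zero _ (by have := h.two_le; lia)))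
  · have hQ := isBalanced_traceQuadratic h u
    have count := hQ.card_excess_eq_top_mul c
    have level := hQ.card_mul_levelCard c
    rw [charSum_traceQuadratic h hK hu, hu] at count
    rw [charSum_traceQuadratic h hK hu, hK] at level
    zify at count level
    linear_combination (Fintype.card F : ℤ) * count + level

lemma card_excess_neg (hFq : Fintype.card F ∣ q) (c : F) (j : ℕ) :
    (#{z : (K × K) × Module.Dual F K | excess (traceQuadratic σ z.1) z.2 c =
      -(-(q : ℤ)) ^ (n + j)} * (Fintype.card F * q ^ (2 * j)) : ℤ) =
      corankCount σ q j * ((Fintype.card F - 1) * q ^ (2 * n) -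
        (if c = 0 then (Fintype.card F : ℤ) - 1 else -1) * (-(q : ℤ)) ^ (n + j)) := by
  have hF := three_le_card F
  have hF_le := Nat.le_of_dvd (zero_lt_two.trans_le h.two_le) hFq
  refine card_filter_mul_eq_corankCount_mul (P := fun u φ => excess (traceQuadratic σ u) φ c = _)
    (fun u φ he => ?_) fun u hu => ?_
  · obtain ⟨i, hi⟩ := exists_natCard_radical_eq h u
    rcases (isBalanced_traceQuadratic h u).excess_trichotomy φ c with h' | h' | h' <;> rw [h'] at he
    · rw [charSum_traceQuadratic h hK hi] at he
      exact absurd he (sub_one_mul_neg_pow_ne hF hF_le _ _)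
    · exact (charSum_traceQuadratic_eq_iff h hK u j).1 (neg_injective he)
    · exact absurd he.symm (neg_ne_zero.2 (pow_ne_zero _ (by have := h.two_le; lia)))
  · have hQ := isBalanced_traceQuadratic h u
    have count := hQ.card_excess_eq_neg_mul c
    have level := hQ.card_mul_levelCard c
    rw [charSum_traceQuadratic h hK hu, hu, hK] at count
    rw [charSum_traceQuadratic h hK hu, hK] at level
    zify at count level
    linear_combination (Fintype.card F : ℤ) * count - level

lemma card_excess_eq_zero (hn : 4 ≤ n) (c : F) :
    (#{z : (K × K) × Module.Dual F K | excess (traceQuadratic σ z.1) z.2 c = 0} : ℚ) =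
      q ^ (2 * n) - 1 + ∑ i : Fin 4,
        corankCount σ q i * ((q : ℚ) ^ (2 * n) - q ^ (2 * n) / q ^ (2 * (i : ℕ))) := by
  have hq : (q : ℚ) ≠ 0 := by
    have := h.two_le
    positivity
  have count (u : K × K) (i : ℕ) (hi : Nat.card (traceQuadratic σ u).radical = q ^ (2 * i)) :
      (#{φ | excess (traceQuadratic σ u) φ c = 0} : ℚ) =
        q ^ (2 * n) - q ^ (2 * n) / q ^ (2 * i) := by
    have := (isBalanced_traceQuadratic h u).card_excess_eq_zero_mul c
    rw [hi, hK] at this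
    field_simp
    rw [mul_sub_one, eq_sub_iff_add_eq]
    exact_mod_cast this
  have total := sum_eq_sum_corankCount h hK hn
    (g := fun i => (q : ℚ) ^ (2 * n) - q ^ (2 * n) / q ^ (2 * i)) count
  rw [div_self (pow_ne_zero _ hq)] at total
  rw [← total, card_filter, Fintype.sum_prod_type, Nat.cast_sum]
  simp only [card_filter]

end

omit [Fintype F] [DecidableEq F] in
lemma corankCount_self (h : IsHermitianFrobenius σ q) (hK : Fintype.card K = q ^ (2 * n))
    (hn : 4 ≤ n) : corankCount σ q n = 1 := by
  have key := sum_eq_sum_corankCount (R := ℤ) h hK hn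
    (G := fun u => if Nat.card (traceQuadratic σ u).radical = q ^ (2 * n) then 1 else 0)
    (g := fun i => if i = n then 1 else 0) fun u i hi => by
      simp only [hi, Nat.pow_right_inj h.two_le, mul_right_inj' two_ne_zero]
  have ne_corank (i : Fin 4) : (i : ℕ) ≠ n := by lia
  simpa [corankCount, ne_corank] using key

end ExcessDistribution

section Families

variable {F K : Type*} [Field F] [Field K] [Algebra F K]

/-- The forms `traceQuadratic σ u` as a linear family of functions of `u`. -/
noncomputable def quadraticFamily (σ : K ≃ₐ[F] K) : K × K →ₗ[F] K → F where
  toFun u := traceQuadratic σ u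
  map_add' u v := by
    ext x
    simp only [traceQuadratic_apply, Pi.add_apply, ← map_add, Prod.fst_add, Prod.snd_add]
    ring_nf
  map_smul' c u := by
    ext x
    simp only [traceQuadratic_apply, Pi.smul_apply, RingHom.id_apply, Prod.smul_fst,
      Prod.smul_snd, smul_mul_assoc, ← smul_add, mul_smul_comm, map_smul]

/-- The sums of a form `traceQuadratic σ u` and a linear form as a linear family of functions. -/
noncomputable def polynomialFamily (σ : K ≃ₐ[F] K) : (K × K) × Module.Dual F K →ₗ[F] K → F :=
  (quadraticFamily σ).coprod (LinearMap.ltoFun F K F F)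

lemma quadraticFamily_apply_zero (σ : K ≃ₐ[F] K) (u : K × K) : quadraticFamily σ u 0 = 0 :=
  (traceQuadratic σ u).map_zero

lemma polynomialFamily_apply_zero (σ : K ≃ₐ[F] K) (z : (K × K) × Module.Dual F K) :
    polynomialFamily σ z 0 = 0 := by
  simp [polynomialFamily, quadraticFamily_apply_zero]

section

variable [Fintype F] [DecidableEq F] [Fintype K]

lemma zeroExcess_quadraticFamily (σ : K ≃ₐ[F] K) (u : K × K) (c : F) :
    (zeroExcess fun x => quadraticFamily σ u x + c) = excess (traceQuadratic σ u) 0 c := by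
  simp [excess, quadraticFamily]

lemma zeroExcess_polynomialFamily (σ : K ≃ₐ[F] K) (z : (K × K) × Module.Dual F K) (c : F) :
    (zeroExcess fun x => polynomialFamily σ z x + c) = excess (traceQuadratic σ z.1) z.2 c := rfl

end

end Families

section FamilyRows

variable {F K : Type*} [Field F] [Fintype F] [DecidableEq F] [Invertible (2 : F)] [Field K]
  [Fintype K] [DecidableEq K] [Algebra F K] {σ : K ≃ₐ[F] K} {q n : ℕ}
  (h : IsHermitianFrobenius σ q) (hK : Fintype.card K = q ^ (2 * n))
include h hK

omit [Fintype F] [DecidableEq F] in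
/-- If a form plus a linear form vanishes, then the form has zero polar form. -/
lemma polynomialFamily_injective (hn : 4 ≤ n) : Function.Injective (polynomialFamily σ) := by
  rw [injective_iff_map_eq_zero]
  rintro ⟨u, φ⟩ hz
  have eq_neg (x : K) : traceQuadratic σ u x = -φ x :=
    eq_neg_of_add_eq_zero_left (congrFun hz x)
  have hu : u = 0 := by
    by_contra hu
    have radical_eq_top : (traceQuadratic σ u).radical = ⊤ := by
      rw [QuadraticMap.radical_eq_ker_polarBilin, LinearMap.ker_eq_top]
      refine LinearMap.ext₂ fun y x => ?_
      simp [QuadraticMap.polar, eq_neg]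
    have card_le := natCard_radical_le h hu
    rw [radical_eq_top, Nat.card_congr Submodule.topEquiv.toEquiv, Nat.card_eq_fintype_card, hK,
      Nat.pow_le_pow_iff_right h.two_le] at card_le
    lia
  subst hu
  refine Prod.ext_iff.2 ⟨rfl, LinearMap.ext fun x => ?_⟩
  simpa [traceQuadratic_zero] using eq_neg x

omit [Fintype F] [DecidableEq F] in
lemma quadraticFamily_injective (hn : 4 ≤ n) : Function.Injective (quadraticFamily σ) := by
  have := polynomialFamily_injective h hK hn
  rw [polynomialFamily] at this
  exact fun u v huv => congrArg Prod.fst (this (a₁ := (u, 0)) (a₂ := (v, 0)) (by simpa using huv))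

variable (hFq : Fintype.card F ∣ q) (hn : 4 ≤ n)
include hFq hn

lemma dvd_zeroExcess_quadraticFamily (u : K × K) (c : F) :
    (Fintype.card F : ℤ) ^ 2 ∣ zeroExcess fun x => quadraticFamily σ u x + c := by
  rw [zeroExcess_quadraticFamily]
  exact dvd_excess_traceQuadratic h hK hFq (by lia) u 0 c

lemma dvd_zeroExcess_polynomialFamily (z : (K × K) × Module.Dual F K) (c : F) :
    (Fintype.card F : ℤ) ^ 2 ∣ zeroExcess fun x => polynomialFamily σ z x + c :=
  dvd_excess_traceQuadratic h hK hFq (by lia) z.1 z.2 c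

omit [DecidableEq F] in
lemma unitWord_polynomialFamily_injective :
    Function.Injective (unitWord (polynomialFamily σ)) := by
  classical
  refine unitWord_injective (polynomialFamily_apply_zero σ)
    (dvd_zeroExcess_polynomialFamily h hK hFq hn) ?_ (polynomialFamily_injective h hK hn)
  rw [hK]
  exact_mod_cast pow_dvd_pow_of_dvd hFq 2 |>.trans (pow_dvd_pow q (by lia))

omit [DecidableEq F] in
lemma unitWord_quadraticFamily_injective :
    Function.Injective (unitWord (quadraticFamily σ)) := by
  classical
  refine unitWord_injective (quadraticFamily_apply_zero σ)
    (dvd_zeroExcess_quadraticFamily h hK hFq hn) ?_ (quadraticFamily_injective h hK hn)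
  rw [hK]
  exact_mod_cast pow_dvd_pow_of_dvd hFq 2 |>.trans (pow_dvd_pow q (by lia))

lemma isWeightRow_quadraticFamily {row : ℤ × ℚ} (j : ℕ) (c : F)
    (hw : Fintype.card F * row.1 = scaledWeight K
      ((if c = 0 then (Fintype.card F : ℤ) - 1 else -1) * (-(q : ℤ)) ^ (n + j)) c)
    (hfreq : row.2 = (if c = 0 then 1 else (Fintype.card F : ℚ) - 1) * corankCount σ q j) :
    IsWeightRow (quadraticFamily σ) row := by
  refine ⟨_, c, (sq_dvd_neg_pow hFq (by lia)).mul_left _, hw, ?_⟩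
  simp only [hfreq, zeroExcess_quadraticFamily]
  rw [card_excess_zero_traceQuadratic h hK]

variable [Fintype (Module.Dual F K)]

lemma isWeightRow_top {row : ℤ × ℚ} (j : ℕ) (c : F)
    (hw : Fintype.card F * row.1 =
      scaledWeight K (((Fintype.card F : ℤ) - 1) * (-(q : ℤ)) ^ (n + j)) c)
    (hfreq : row.2 * (Fintype.card F * q ^ (2 * j)) =
      (if c = 0 then 1 else (Fintype.card F : ℚ) - 1) * (corankCount σ q j * (q ^ (2 * n) +
        (if c = 0 then (Fintype.card F : ℚ) - 1 else -1) * (-(q : ℚ)) ^ (n + j)))) :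
    IsWeightRow (polynomialFamily σ) row := by
  have hq : (q : ℚ) ≠ 0 := by exact_mod_cast (zero_lt_two.trans_le h.two_le).ne'
  refine ⟨_, c, (sq_dvd_neg_pow hFq (by lia)).mul_left _, hw, ?_⟩
  have count := congrArg (Int.cast (R := ℚ)) (card_excess_top h hK hFq c j)
  push_cast at count
  refine mul_right_cancel₀ (mul_ne_zero (Nat.cast_ne_zero.2 (Fintype.card_ne_zero (α := F)))
    (pow_ne_zero (2 * j) hq)) ?_
  rw [hfreq, mul_assoc, ← count]
  rfl

lemma isWeightRow_neg {row : ℤ × ℚ} (j : ℕ) (c : F)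
    (hw : Fintype.card F * row.1 = scaledWeight K (-(-(q : ℤ)) ^ (n + j)) c)
    (hfreq : row.2 * (Fintype.card F * q ^ (2 * j)) =
      (if c = 0 then 1 else (Fintype.card F : ℚ) - 1) *
        (corankCount σ q j * ((Fintype.card F - 1) * q ^ (2 * n) -
          (if c = 0 then (Fintype.card F : ℚ) - 1 else -1) * (-(q : ℚ)) ^ (n + j)))) :
    IsWeightRow (polynomialFamily σ) row := by
  have hq : (q : ℚ) ≠ 0 := by exact_mod_cast (zero_lt_two.trans_le h.two_le).ne'
  refine ⟨_, c, (sq_dvd_neg_pow hFq (by lia)).neg_right, hw, ?_⟩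
  have count := congrArg (Int.cast (R := ℚ)) (card_excess_neg h hK hFq c j)
  push_cast at count
  refine mul_right_cancel₀ (mul_ne_zero (Nat.cast_ne_zero.2 (Fintype.card_ne_zero (α := F)))
    (pow_ne_zero (2 * j) hq)) ?_
  rw [hfreq, mul_assoc, ← count]
  rfl

omit hFq in
lemma isWeightRow_zero {row : ℤ × ℚ} (c : F)
    (hw : Fintype.card F * row.1 = scaledWeight K 0 c)
    (hfreq : row.2 = (if c = 0 then 1 else (Fintype.card F : ℚ) - 1) *
      (q ^ (2 * n) - 1 + ∑ i : Fin 4,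
        corankCount σ q i * ((q : ℚ) ^ (2 * n) - q ^ (2 * n) / q ^ (2 * (i : ℕ))))) :
    IsWeightRow (polynomialFamily σ) row := by
  refine ⟨0, c, dvd_zero _, hw, ?_⟩
  rw [hfreq, ← card_excess_eq_zero h hK hn c]
  rfl

end FamilyRows

section Occurrence

variable {F K : Type*} [Field F] [Fintype F] [DecidableEq F] [Invertible (2 : F)] [Field K]
  [Fintype K] [DecidableEq K] [Algebra F K] {σ : K ≃ₐ[F] K} {q n : ℕ}
  (h : IsHermitianFrobenius σ q) (hK : Fintype.card K = q ^ (2 * n))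
include h hK

lemma excess_traceQuadratic_zero_cases (u : K × K) (c : F) :
    ∃ j, (j = n ∨ ∃ i : Fin 4, j = i) ∧ excess (traceQuadratic σ u) 0 c =
      (if c = 0 then (Fintype.card F : ℤ) - 1 else -1) * (-(q : ℤ)) ^ (n + j) := by
  rw [(isBalanced_traceQuadratic h u).excess_zero]
  by_cases hu : u = 0
  · rw [hu, charSum_traceQuadratic h hK (natCard_radical_traceQuadratic_zero hK)]
    exact ⟨n, .inl rfl, rfl⟩
  · obtain ⟨i, hi⟩ := exists_natCard_radical_eq_of_ne_zero h hu
    rw [charSum_traceQuadratic h hK hi]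
    exact ⟨i, .inr ⟨i, rfl⟩, rfl⟩

lemma excess_traceQuadratic_cases (u : K × K) (φ : Module.Dual F K) (c : F) :
    excess (traceQuadratic σ u) φ c = 0 ∨
      excess (traceQuadratic σ u) φ c =
        (if c = 0 then (Fintype.card F : ℤ) - 1 else -1) * (-(q : ℤ)) ^ (n + n) ∨
      ∃ i : Fin 4,
        excess (traceQuadratic σ u) φ c = ((Fintype.card F : ℤ) - 1) * (-(q : ℤ)) ^ (n + i) ∨
        excess (traceQuadratic σ u) φ c = -(-(q : ℤ)) ^ (n + i) := by
  have hQ := isBalanced_traceQuadratic h u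
  by_cases hu : u = 0
  · subst hu
    by_cases hφ : φ = 0
    · rw [hφ, hQ.excess_zero, charSum_traceQuadratic h hK (natCard_radical_traceQuadratic_zero hK)]
      exact .inr (.inl rfl)
    · refine .inl (excess_eq_zero (fun ⟨y, hy⟩ => hφ ?_) c)
      rw [← hy]
      ext x
      rw [polarBilin_traceQuadratic]
      simp
  · obtain ⟨i, hi⟩ := exists_natCard_radical_eq_of_ne_zero h hu
    rcases hQ.excess_trichotomy φ c with he | he | he
    · exact .inr (.inr ⟨i, .inl (charSum_traceQuadratic h hK hi ▸ he)⟩)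
    · exact .inr (.inr ⟨i, .inr (charSum_traceQuadratic h hK hi ▸ he)⟩)
    · exact .inl he

end Occurrence

lemma card_filter_pow_eq_self {K : Type*} [Field K] [Fintype K] [DecidableEq K] {r : ℕ}
    (hr : r - 1 ∣ Fintype.card K - 1) : #{x : K | x ^ r = x} = r := by
  obtain ⟨e, he⟩ := hr
  have two_le : 2 ≤ r := by
    have := Fintype.one_lt_card (α := K)
    by_contra! hr
    rw [Nat.sub_eq_zero_of_le (by lia : r ≤ 1), zero_mul] at he
    lia
  obtain ⟨d, rfl⟩ := Nat.exists_eq_add_of_le' (one_le_two.trans two_le)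
  have card_units : Nat.card Kˣ = d * e := by
    rw [Nat.card_units, Nat.card_eq_fintype_card, he, Nat.add_sub_cancel]
  rw [card_filter_eq_card_units_add, zero_pow (by lia), if_pos rfl]
  have pow_eq_self_iff (t : Kˣ) : (t : K) ^ (d + 1) = t ↔ t ^ d = 1 := by
    rw [← Units.val_pow_eq_pow_val, Units.val_inj, pow_succ, mul_eq_right]
  simp only [pow_eq_self_iff]
  rw [card_pow_eq_of_pow_eq_one card_units (one_pow e)]

section Exponents

variable {n m ℓ : ℕ}

lemma gcd_two_mul_eq (hm : m = 2 * (n * m.gcd ℓ)) : (2 * ℓ).gcd m = 2 * m.gcd ℓ := by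
  have gcd_half : ℓ.gcd (n * m.gcd ℓ) = m.gcd ℓ :=
    Nat.dvd_antisymm
      (Nat.dvd_gcd ((Nat.gcd_dvd_right _ _).trans ⟨2, by lia⟩) (Nat.gcd_dvd_left _ _))
      (Nat.dvd_gcd (Nat.gcd_dvd_right _ _) (dvd_mul_left _ _))
  conv_lhs => rw [hm, Nat.gcd_mul_left, gcd_half]

lemma exists_eq_gcd_add (hδ : m.gcd ℓ ≠ 0) (hm : m = 2 * (n * m.gcd ℓ)) :
    ∃ k, ℓ = m.gcd ℓ + 2 * m.gcd ℓ * k := by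
  obtain ⟨l, hl⟩ := Nat.gcd_dvd_right m ℓ
  obtain ⟨k, rfl | rfl⟩ := Nat.even_or_odd' l
  · have two_mul_dvd : 2 * m.gcd ℓ ∣ m.gcd ℓ := Nat.dvd_gcd ⟨n, by linarith⟩ ⟨k, by linarith⟩
    have := Nat.le_of_dvd (Nat.pos_of_ne_zero hδ) two_mul_dvd
    lia
  · exact ⟨k, by linarith⟩

lemma pow_eq_pow_gcd_pow (p : ℕ) (hm : m = 2 * (n * m.gcd ℓ)) :
    p ^ m = (p ^ m.gcd ℓ) ^ (2 * n) := by
  rw [← pow_mul]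
  congr 1
  linarith

end Exponents

section Frobenius

variable {p : ℕ} [Fact p.Prime] {K : Type*} [Field K] [Fintype K] [Algebra (ZMod p) K]
  {σ : K ≃ₐ[ZMod p] K} {n m ℓ : ℕ}

variable (p K) in
omit [Fintype K] in
lemma exists_frobenius_pow [Finite K] (ℓ : ℕ) : ∃ σ : K ≃ₐ[ZMod p] K, ∀ x, σ x = x ^ p ^ ℓ :=
  ⟨FiniteField.frobeniusAlgEquivOfAlgebraic (ZMod p) K ^ ℓ, fun x => by
    rw [AlgEquiv.coe_pow, FiniteField.coe_frobeniusAlgEquivOfAlgebraic_iterate, ZMod.card]⟩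

lemma isHermitianFrobenius [DecidableEq K] (hσ : ∀ x, σ x = x ^ p ^ ℓ)
    (hK : Fintype.card K = p ^ m) (hδ : m.gcd ℓ ≠ 0) (hm : m = 2 * (n * m.gcd ℓ)) :
    IsHermitianFrobenius σ (p ^ m.gcd ℓ) := by
  have isPeriodicPt_iff (k : ℕ) (x : K) :
      Function.IsPeriodicPt (fun y : K => y ^ p) k x ↔ x ^ p ^ k = x := by
    rw [Function.IsPeriodicPt, Function.IsFixedPt, pow_iterate]
  have fix_iff (x : K) : σ (σ x) = x ↔ x ^ p ^ (2 * m.gcd ℓ) = x := by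
    rw [hσ, hσ, ← pow_mul, ← pow_add, ← two_mul, ← isPeriodicPt_iff, ← isPeriodicPt_iff]
    refine ⟨fun hx => ?_, fun hx => hx.trans_dvd (Nat.mul_dvd_mul_left 2 (Nat.gcd_dvd_right m ℓ))⟩
    rw [← gcd_two_mul_eq hm]
    exact hx.gcd ((isPeriodicPt_iff m x).2 (hK ▸ FiniteField.pow_card x))
  refine ⟨?_, fun x hx => ?_⟩
  · simp only [fix_iff, mul_comm 2, pow_mul]
    refine card_filter_pow_eq_self ?_
    rw [hK, pow_eq_pow_gcd_pow p hm, pow_mul]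
    simpa using Nat.sub_dvd_pow_sub_pow ((p ^ m.gcd ℓ) ^ 2) 1 n
  · obtain ⟨k, hk⟩ := exists_eq_gcd_add hδ hm
    have periodic := ((isPeriodicPt_iff _ x).2 ((fix_iff x).1 hx)).mul_const k
    calc σ x = (x ^ p ^ (2 * m.gcd ℓ * k)) ^ p ^ m.gcd ℓ := by
          rw [hσ, ← pow_mul, ← pow_add, add_comm, ← hk]
      _ = x ^ p ^ m.gcd ℓ := by rw [(isPeriodicPt_iff _ x).1 periodic]

omit [Fintype K] in
lemma trace_mul_eval (hσ : ∀ x, σ x = x ^ p ^ ℓ) (u : K × K) (x : K) :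
    Algebra.trace (ZMod p) K
      (x * (u.1 • X ^ p ^ ℓ + u.2 • X ^ p ^ (3 * ℓ) : K[X]).eval x) = traceQuadratic σ u x := by
  have pow_three : x ^ p ^ (3 * ℓ) = σ (σ (σ x)) := by
    rw [hσ, hσ, hσ, ← pow_mul, ← pow_mul, ← pow_add, ← pow_add]
    ring_nf
  simp only [eval_add, eval_smul, eval_pow, eval_X, smul_eq_mul]
  rw [pow_three, ← hσ, traceQuadratic_apply]

omit [Fintype K] in
lemma code0_eq_range (hσ : ∀ x, σ x = x ^ p ^ ℓ) :
    code0 p (linFamily p K ℓ) = LinearMap.range (unitWord (quadraticFamily σ)) := by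
  ext c
  constructor
  · rintro ⟨R, hR, b, rfl⟩
    obtain ⟨a, a', rfl⟩ := Submodule.mem_span_pair.1 hR
    exact ⟨((a, a'), b), funext fun x => by rw [trace_mul_eval hσ (a, a')]; rfl⟩
  · rintro ⟨⟨u, b⟩, rfl⟩
    exact ⟨_, Submodule.mem_span_pair.2 ⟨u.1, u.2, rfl⟩, b,
      funext fun x => by rw [trace_mul_eval hσ u]; rfl⟩

omit [Fintype K] in
lemma code2_eq_range [Finite K] (hσ : ∀ x, σ x = x ^ p ^ ℓ) :
    code2 p (linFamily p K ℓ) = LinearMap.range (unitWord (polynomialFamily σ)) := by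
  ext c
  constructor
  · rintro ⟨R, hR, β, b, rfl⟩
    obtain ⟨a, a', rfl⟩ := Submodule.mem_span_pair.1 hR
    refine ⟨(((a, a'), Algebra.traceForm (ZMod p) K β), b), funext fun x => ?_⟩
    rw [map_add, trace_mul_eval hσ (a, a')]
    rfl
  · rintro ⟨⟨⟨u, φ⟩, b⟩, rfl⟩
    obtain ⟨β, rfl⟩ := ((Algebra.traceForm (ZMod p) K).toDual
      (traceForm_nondegenerate (ZMod p) K)).surjective φ
    refine ⟨_, Submodule.mem_span_pair.2 ⟨u.1, u.2, rfl⟩, β, b, funext fun x => ?_⟩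
    rw [map_add, trace_mul_eval hσ u]
    rfl

end Frobenius

section TableExponents

variable {p n m ℓ : ℕ} (hδ : m.gcd ℓ ≠ 0) (hm : m = 2 * (n * m.gcd ℓ))
include hδ hm

lemma eps_eq : eps m ℓ = (-1) ^ n := by
  have quotient_eq : m / m.gcd ℓ = 2 * n :=
    Nat.div_eq_of_eq_mul_left (Nat.pos_of_ne_zero hδ) (by linarith)
  rw [eps, quotient_eq, Nat.mul_div_cancel_left n two_pos]

omit hδ in
lemma neg_pow_two_mul_eq (p : ℕ) : (-((p ^ m.gcd ℓ : ℕ) : ℤ)) ^ (n + n) = p ^ m := by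
  rw [← two_mul, (even_two_mul n).neg_pow]
  exact_mod_cast (pow_eq_pow_gcd_pow p hm).symm

omit hδ in
lemma cast_pow_two_mul_eq (p : ℕ) : ((p ^ m.gcd ℓ : ℕ) : ℚ) ^ (2 * n) = p ^ m := by
  exact_mod_cast (pow_eq_pow_gcd_pow p hm).symm

omit hδ in
lemma half_eq : m / 2 = n * m.gcd ℓ := by lia

variable (hn : 4 ≤ n)
include hn

omit hm in
lemma gcd_mul_lt (i : Fin 4) : i * m.gcd ℓ < n * m.gcd ℓ := by
  gcongr
  lia

lemma exponent_ne_zero : m ≠ 0 := by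
  have := gcd_mul_lt (ℓ := ℓ) hδ hn 0
  omega

lemma rank_ne_zero (i : Fin 4) : m - 2 * i * m.gcd ℓ ≠ 0 := by
  have := gcd_mul_lt (ℓ := ℓ) hδ hn i
  rw [mul_assoc]
  omega

lemma mul_sgn_mul_pow (i : Fin 4) :
    (p * (sgn m ℓ i * p ^ (m / 2 + i * m.gcd ℓ - 1)) : ℤ) =
      (-((p ^ m.gcd ℓ : ℕ) : ℤ)) ^ (n + (i : ℕ)) := by
  have lt := gcd_mul_lt (ℓ := ℓ) hδ hn i
  have exponent : n * m.gcd ℓ + i * m.gcd ℓ - 1 + 1 = m.gcd ℓ * (n + i) := by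
    rw [mul_add, mul_comm _ n, mul_comm _ (i : ℕ)]
    omega
  rw [sgn, eps_eq hδ hm, half_eq hm, neg_pow ((p ^ m.gcd ℓ : ℕ) : ℤ), Nat.cast_pow, ← pow_mul,
    ← exponent]
  ring

lemma sgn_mul_pow_mul (i : Fin 4) :
    (sgn m ℓ i * p ^ (m / 2 - i * m.gcd ℓ - 1) *
        (p * ((p ^ m.gcd ℓ : ℕ) : ℚ) ^ (2 * (i : ℕ))) : ℚ) =
      (-((p ^ m.gcd ℓ : ℕ) : ℚ)) ^ (n + (i : ℕ)) := by
  have lt := gcd_mul_lt (ℓ := ℓ) hδ hn i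
  have exponent : m.gcd ℓ * (n + i) = n * m.gcd ℓ - i * m.gcd ℓ - 1 + 1 + m.gcd ℓ * (2 * i) := by
    rw [mul_add, mul_left_comm, mul_comm _ n, mul_comm _ (i : ℕ)]
    omega
  rw [sgn, eps_eq hδ hm, half_eq hm, neg_pow ((p ^ m.gcd ℓ : ℕ) : ℚ), Nat.cast_pow, ← pow_mul,
    ← pow_mul, exponent]
  push_cast
  ring

lemma pow_rank_mul (i : Fin 4) :
    (p : ℚ) ^ (m - 2 * i * m.gcd ℓ) * ((p ^ m.gcd ℓ : ℕ) : ℚ) ^ (2 * (i : ℕ)) = p ^ m := by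
  have lt := gcd_mul_lt (ℓ := ℓ) hδ hn i
  rw [Nat.cast_pow, ← pow_mul, ← pow_add]
  congr 1
  rw [mul_comm _ (2 * (i : ℕ)), mul_assoc]
  omega

lemma pow_rank_sub_one_mul (i : Fin 4) :
    (p : ℚ) ^ (m - 2 * i * m.gcd ℓ - 1) * (p * ((p ^ m.gcd ℓ : ℕ) : ℚ) ^ (2 * (i : ℕ))) =
      p ^ m := by
  rw [← pow_rank_mul hδ hm hn i, ← mul_assoc, pow_sub_one_mul (rank_ne_zero hδ hm hn i)]

end TableExponents

lemma mul_eq_scaledWeight_iff {p m : ℕ} [Fact p.Prime] {K : Type*} [Fintype K] (hm : m ≠ 0)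
    (hK : Fintype.card K = p ^ m) {w e : ℤ} {c : ZMod p} :
    (p : ℤ) * w = scaledWeight K e c ↔
      e = p * (p ^ m - p ^ (m - 1) - (if c = 0 then 0 else 1) - w) := by
  have pow_eq : (p : ℤ) * p ^ (m - 1) = p ^ m := mul_pow_sub_one hm _
  rw [scaledWeight, ZMod.card, hK]
  push_cast
  split_ifs <;> exact ⟨fun h => by linear_combination h + pow_eq,
    fun h => by linear_combination h - pow_eq⟩

section Tables

variable {p : ℕ} [Fact p.Prime] [Invertible (2 : ZMod p)] {K : Type*} [Field K] [Fintype K]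
  [DecidableEq K] [Algebra (ZMod p) K] {σ : K ≃ₐ[ZMod p] K} {n m ℓ : ℕ}

variable (h : IsHermitianFrobenius σ (p ^ m.gcd ℓ)) (hK : Fintype.card K = p ^ m)
  (hδ : m.gcd ℓ ≠ 0) (hm : m = 2 * (n * m.gcd ℓ)) (hn : 4 ≤ n)
include h hK hδ hm hn

lemma corankCount_eq_freq (i : Fin 4) : (corankCount σ (p ^ m.gcd ℓ) i : ℚ) = freq p m ℓ i := by
  have moments := solvesMoments_corankCount h (hK.trans (pow_eq_pow_gcd_pow p hm)) hn
  refine congrFun (SolvesMoments.eq_freq (g := fun i => corankCount σ (p ^ m.gcd ℓ) i)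
    (Fact.out : p.Prime).one_lt hm hδ (Nat.mul_le_mul_right _ (by lia)) ?_) i
  rw [eps_eq hδ hm, mul_comm n, pow_mul]
  exact_mod_cast moments

lemma isWeightRow_table0 {row : ℤ × ℚ} (hrow : row ∈ table0 p m ℓ) :
    IsWeightRow (quadraticFamily σ) row := by
  have hm0 := exponent_ne_zero hδ hm hn
  have hK' := hK.trans (pow_eq_pow_gcd_pow p hm)
  have isRow := isWeightRow_quadraticFamily (row := row) h hK'
    ((ZMod.card p).dvd.trans (dvd_pow_self p hδ)) hn
  have self := corankCount_self h hK' hn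
  have pow_self := neg_pow_two_mul_eq hm p
  have rank := corankCount_eq_freq h hK hδ hm hn
  simp only [ZMod.card, mul_eq_scaledWeight_iff hm0 hK] at isRow
  simp only [table0, List.mem_append, List.mem_cons, List.mem_flatMap, List.mem_finRange, true_and,
    List.not_mem_nil, or_false] at hrow
  rcases hrow with (rfl | rfl) | ⟨i, rfl | rfl⟩
  · refine isRow n 0 ?_ ?_
    · simp only [pow_self, if_true]
      linear_combination mul_pow_sub_one hm0 (p : ℤ)
    · simp [self]
  · refine isRow n 1 ?_ ?_
    · simp only [pow_self, one_ne_zero, if_false]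
      linear_combination mul_pow_sub_one hm0 (p : ℤ)
    · simp [self]
  · refine isRow i 0 ?_ ?_
    · simp only [← mul_sgn_mul_pow hδ hm hn i, if_true]
      ring
    · simp [rank]
  · refine isRow i 1 ?_ ?_
    · simp only [← mul_sgn_mul_pow hδ hm hn i, one_ne_zero, if_false]
      ring
    · simp [rank]

variable [Fintype (Module.Dual (ZMod p) K)]

lemma isWeightRow_rank_top (i : Fin 4) (c : ZMod p) {row : ℤ × ℚ}
    (hw : row.1 = p ^ m - p ^ (m - 1) - (if c = 0 then 0 else 1)
      - sgn m ℓ i * (p - 1) * p ^ (m / 2 + i * m.gcd ℓ - 1))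
    (hfreq : row.2 = (p ^ (m - 2 * i * m.gcd ℓ - 1)
      + sgn m ℓ i * (if c = 0 then (p : ℚ) - 1 else -1) * p ^ (m / 2 - i * m.gcd ℓ - 1))
      * (if c = 0 then 1 else (p : ℚ) - 1) * freq p m ℓ i) :
    IsWeightRow (polynomialFamily σ) row := by
  have hm0 := exponent_ne_zero hδ hm hn
  refine isWeightRow_top h (hK.trans (pow_eq_pow_gcd_pow p hm))
    ((ZMod.card p).dvd.trans (dvd_pow_self p hδ)) hn i c ?_ ?_
  · rw [ZMod.card, mul_eq_scaledWeight_iff hm0 hK, ← mul_sgn_mul_pow hδ hm hn, hw]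
    ring
  · rw [ZMod.card, corankCount_eq_freq h hK hδ hm hn, cast_pow_two_mul_eq hm,
      ← sgn_mul_pow_mul hδ hm hn, ← pow_rank_sub_one_mul hδ hm hn i, hfreq]
    ring

lemma isWeightRow_rank_neg (i : Fin 4) (c : ZMod p) {row : ℤ × ℚ}
    (hw : row.1 = p ^ m - p ^ (m - 1) - (if c = 0 then 0 else 1)
      + sgn m ℓ i * p ^ (m / 2 + i * m.gcd ℓ - 1))
    (hfreq : row.2 = (p ^ (m - 2 * i * m.gcd ℓ) - p ^ (m - 2 * i * m.gcd ℓ - 1)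
      - sgn m ℓ i * (if c = 0 then (p : ℚ) - 1 else -1) * p ^ (m / 2 - i * m.gcd ℓ - 1))
      * (if c = 0 then 1 else (p : ℚ) - 1) * freq p m ℓ i) :
    IsWeightRow (polynomialFamily σ) row := by
  have hm0 := exponent_ne_zero hδ hm hn
  have powers := pow_rank_mul (p := p) hδ hm hn i
  have powers' := pow_rank_sub_one_mul (p := p) hδ hm hn i
  refine isWeightRow_neg h (hK.trans (pow_eq_pow_gcd_pow p hm))
    ((ZMod.card p).dvd.trans (dvd_pow_self p hδ)) hn i c ?_ ?_
  · rw [ZMod.card, mul_eq_scaledWeight_iff hm0 hK, ← mul_sgn_mul_pow hδ hm hn, hw]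
    ring
  · rw [ZMod.card, corankCount_eq_freq h hK hδ hm hn, cast_pow_two_mul_eq hm,
      ← sgn_mul_pow_mul hδ hm hn, hfreq]
    linear_combination (if c = 0 then 1 else (p : ℚ) - 1) * freq p m ℓ i * (p * powers - powers')

lemma isWeightRow_const {row : ℤ × ℚ}
    (hrow : row = (0, 1) ∨ row = ((p : ℤ) ^ m - 1, (p : ℚ) - 1)) :
    IsWeightRow (polynomialFamily σ) row := by
  have hm0 := exponent_ne_zero hδ hm hn
  have hK' := hK.trans (pow_eq_pow_gcd_pow p hm)
  have hFq := (ZMod.card p).dvd.trans (dvd_pow_self p hδ)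
  have pow_self := neg_pow_two_mul_eq hm p
  have pow_self' : (-((p ^ m.gcd ℓ : ℕ) : ℚ)) ^ (n + n) = p ^ m := by
    exact_mod_cast congrArg (Int.cast (R := ℚ)) pow_self
  rcases hrow with rfl | rfl
  · refine isWeightRow_top h hK' hFq hn n 0 ?_ ?_
    · rw [ZMod.card, mul_eq_scaledWeight_iff hm0 hK, pow_self, if_pos rfl]
      linear_combination mul_pow_sub_one hm0 (p : ℤ)
    · rw [ZMod.card, corankCount_self h hK' hn, cast_pow_two_mul_eq hm, pow_self', if_pos rfl,
        if_pos rfl]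
      ring
  · refine isWeightRow_neg h hK' hFq hn n 1 ?_ ?_
    · rw [ZMod.card, mul_eq_scaledWeight_iff hm0 hK, pow_self, if_neg one_ne_zero]
      linear_combination mul_pow_sub_one hm0 (p : ℤ)
    · rw [ZMod.card, corankCount_self h hK' hn, cast_pow_two_mul_eq hm, pow_self',
        if_neg one_ne_zero, if_neg one_ne_zero]
      ring

lemma isWeightRow_mid (c : ZMod p) {row : ℤ × ℚ}
    (hw : row.1 = p ^ m - p ^ (m - 1) - if c = 0 then 0 else 1)
    (hfreq : row.2 = (if c = 0 then 1 else (p : ℚ) - 1) * (p ^ m - 1 +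
      ∑ i : Fin 4, freq p m ℓ i * (p ^ m - p ^ (m - 2 * i * m.gcd ℓ)))) :
    IsWeightRow (polynomialFamily σ) row := by
  have hm0 := exponent_ne_zero hδ hm hn
  have hp : (p : ℚ) ≠ 0 := Nat.cast_ne_zero.2 (Fact.out : p.Prime).ne_zero
  refine isWeightRow_zero h (hK.trans (pow_eq_pow_gcd_pow p hm)) hn c ?_ ?_
  · rw [ZMod.card, mul_eq_scaledWeight_iff hm0 hK, hw]
    ring
  · rw [ZMod.card, hfreq, cast_pow_two_mul_eq hm]
    refine congrArg _ (congrArg _ (sum_congr rfl fun i _ => ?_))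
    rw [corankCount_eq_freq h hK hδ hm hn, eq_div_of_mul_eq (by simp [hp])
      (pow_rank_mul hδ hm hn i)]

lemma isWeightRow_table2 {row : ℤ × ℚ} (hrow : row ∈ table2 p m ℓ) :
    IsWeightRow (polynomialFamily σ) row := by
  have mid := isWeightRow_mid (row := row) h hK hδ hm hn
  have top := isWeightRow_rank_top (row := row) h hK hδ hm hn
  have neg := isWeightRow_rank_neg (row := row) h hK hδ hm hn
  simp only [table2, List.mem_append, List.mem_cons, List.mem_flatMap, List.mem_finRange, true_and,
    List.not_mem_nil, or_false] at hrow
  rcases hrow with (hrow | hrow | rfl | rfl) | ⟨i, rfl | rfl | rfl | rfl⟩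
  · exact isWeightRow_const h hK hδ hm hn (.inl hrow)
  · exact isWeightRow_const h hK hδ hm hn (.inr hrow)
  · refine mid 0 ?_ ?_ <;> simp only [if_true] <;> ring
  · refine mid 1 ?_ ?_ <;> simp only [one_ne_zero, if_false]
  · refine top i 0 ?_ ?_ <;> simp only [if_true] <;> ring
  · refine neg i 0 ?_ ?_ <;> simp only [if_true]
    · ring
    · linear_combination freq p m ℓ i * mul_pow_sub_one (rank_ne_zero hδ hm hn i) (p : ℚ)
  · refine top i 1 ?_ ?_ <;> simp only [one_ne_zero, if_false]; ring
  · refine neg i 1 ?_ ?_ <;> simp only [one_ne_zero, if_false]; ring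

omit [Fintype (Module.Dual (ZMod p) K)] in
lemma exists_mem_table0 (u : K × K) (c : ZMod p) : ∃ row ∈ table0 p m ℓ,
    Fintype.card (ZMod p) * row.1 =
      scaledWeight K (zeroExcess fun x => quadraticFamily σ u x + c) c := by
  have hm0 := exponent_ne_zero hδ hm hn
  simp only [ZMod.card, mul_eq_scaledWeight_iff hm0 hK, zeroExcess_quadraticFamily, table0,
    List.mem_append, List.mem_cons, List.mem_flatMap, List.mem_finRange, true_and,
    List.not_mem_nil, or_false]
  obtain ⟨j, rfl | ⟨i, rfl⟩, he⟩ :=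
    excess_traceQuadratic_zero_cases h (hK.trans (pow_eq_pow_gcd_pow p hm)) u c
  · rw [he, neg_pow_two_mul_eq hm, ZMod.card]
    split_ifs
    · exact ⟨_, .inl (.inl rfl), by linear_combination mul_pow_sub_one hm0 (p : ℤ)⟩
    · exact ⟨_, .inl (.inr rfl), by linear_combination mul_pow_sub_one hm0 (p : ℤ)⟩
  · rw [he, ← mul_sgn_mul_pow hδ hm hn, ZMod.card]
    split_ifs
    · exact ⟨_, .inr ⟨i, .inl rfl⟩, by ring⟩
    · exact ⟨_, .inr ⟨i, .inr rfl⟩, by ring⟩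

omit [Fintype (Module.Dual (ZMod p) K)] in
lemma exists_mem_table2 (z : (K × K) × Module.Dual (ZMod p) K) (c : ZMod p) :
    ∃ row ∈ table2 p m ℓ, Fintype.card (ZMod p) * row.1 =
      scaledWeight K (zeroExcess fun x => polynomialFamily σ z x + c) c := by
  have hm0 := exponent_ne_zero hδ hm hn
  simp only [ZMod.card, mul_eq_scaledWeight_iff hm0 hK, zeroExcess_polynomialFamily, table2,
    List.mem_append, List.mem_cons, List.mem_flatMap, List.mem_finRange, true_and,
    List.not_mem_nil, or_false]
  rcases excess_traceQuadratic_cases h (hK.trans (pow_eq_pow_gcd_pow p hm)) z.1 z.2 c with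
    he | he | ⟨i, he | he⟩ <;> rw [he]
  · split_ifs
    · exact ⟨_, .inl (.inr (.inr (.inl rfl))), by ring⟩
    · exact ⟨_, .inl (.inr (.inr (.inr rfl))), by ring⟩
  · rw [neg_pow_two_mul_eq hm, ZMod.card]
    split_ifs
    · exact ⟨_, .inl (.inl rfl), by linear_combination mul_pow_sub_one hm0 (p : ℤ)⟩
    · exact ⟨_, .inl (.inr (.inl rfl)), by linear_combination mul_pow_sub_one hm0 (p : ℤ)⟩
  · rw [← mul_sgn_mul_pow hδ hm hn, ZMod.card]
    split_ifs
    · exact ⟨_, .inr ⟨i, .inl rfl⟩, by ring⟩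
    · exact ⟨_, .inr ⟨i, .inr (.inr (.inl rfl))⟩, by ring⟩
  · rw [← mul_sgn_mul_pow hδ hm hn]
    split_ifs
    · exact ⟨_, .inr ⟨i, .inr (.inl rfl)⟩, by ring⟩
    · exact ⟨_, .inr ⟨i, .inr (.inr (.inr rfl))⟩, by ring⟩

omit [Fintype (Module.Dual (ZMod p) K)] in
lemma hasWeightDistribution_quadraticFamily :
    HasWeightDistribution (LinearMap.range (unitWord (quadraticFamily σ))) (table0 p m ℓ) := by
  have hK' := hK.trans (pow_eq_pow_gcd_pow p hm)
  have hFq := (ZMod.card p).dvd.trans (dvd_pow_self p hδ)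
  exact hasWeightDistribution_range_unitWord (quadraticFamily_apply_zero σ)
    (dvd_zeroExcess_quadraticFamily h hK' hFq hn)
    (unitWord_quadraticFamily_injective h hK' hFq hn)
    (fun _ => isWeightRow_table0 h hK hδ hm hn) (exists_mem_table0 h hK hδ hm hn)

omit [Fintype (Module.Dual (ZMod p) K)] in
lemma hasWeightDistribution_polynomialFamily :
    HasWeightDistribution (LinearMap.range (unitWord (polynomialFamily σ))) (table2 p m ℓ) := by
  have hK' := hK.trans (pow_eq_pow_gcd_pow p hm)
  have hFq := (ZMod.card p).dvd.trans (dvd_pow_self p hδ)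
  have := Module.finite_of_finite (ZMod p) (M := Module.Dual (ZMod p) K)
  have := Fintype.ofFinite (Module.Dual (ZMod p) K)
  exact hasWeightDistribution_range_unitWord (polynomialFamily_apply_zero σ)
    (dvd_zeroExcess_polynomialFamily h hK' hFq hn)
    (unitWord_polynomialFamily_injective h hK' hFq hn)
    (fun _ => isWeightRow_table2 h hK hδ hm hn) (exists_mem_table2 h hK hδ hm hn)

end Tables

lemma exists_isLeast_dist {F ι : Type*} [Field F] [DecidableEq F] [Fintype ι]
    {C : Submodule F (ι → F)} {T : List (ℤ × ℚ)} (hT : HasWeightDistribution C T) {v w : ℤ}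
    {f : ℚ} (hmem : (v, f) ∈ T) (hv : v = w) (hw : w ≠ 0) (hf : f ≠ 0)
    (hle : ∀ row ∈ T, row.1 = 0 ∨ w ≤ row.1) :
    ∃ d : ℕ, (d : ℤ) = w ∧
      IsLeast {e | ∃ c ∈ C, ∃ c' ∈ C, c ≠ c' ∧ hammingDist c c' = e} d := by
  subst hv
  have freq_ne : weightFreq C v ≠ 0 := by
    exact_mod_cast (hT.1 _ hmem).trans_ne hf
  obtain ⟨c₀, hc₀, norm_eq⟩ := Set.nonempty_of_ncard_ne_zero freq_ne
  refine ⟨hammingNorm c₀, norm_eq, ⟨c₀, hc₀, 0, C.zero_mem, ?_, hammingDist_zero_right c₀⟩, ?_⟩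
  · rintro rfl
    exact hw (by simpa using norm_eq.symm)
  · rintro e ⟨c, hc, c', hc', hne, rfl⟩
    obtain ⟨row, hrow, dist_eq⟩ := hT.2 (-c + c') (C.add_mem (C.neg_mem hc) hc')
    rw [← hammingDist_eq_hammingNorm] at dist_eq
    rcases hle row hrow with h | h
    · rw [h, Nat.cast_eq_zero, hammingDist_eq_zero] at dist_eq
      exact absurd dist_eq hne
    · exact_mod_cast (norm_eq.trans_le h).trans_eq dist_eq.symm

section DominantDeviation

variable {ι : Type*} {p : ℤ} {s u : ι → ℤ} {k : ι} (hp : 3 ≤ p) (hs : ∀ i, |s i| = 1)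
  (hu : ∀ i, 0 < u i) (hdom : ∀ i ≠ k, p * u i ≤ u k)
include hp hs hu hdom

lemma mul_le_and_neg_le_of_sign_neg (hk : s k = -1) (i : ι) :
    s i * (p - 1) * u i ≤ u k ∧ -u k ≤ s i * u i := by
  have nonneg : 0 ≤ (p - 1) * u i := mul_nonneg (by linarith) (hu i).le
  obtain rfl | hi := eq_or_ne i k
  · rw [hk]
    constructor <;> linarith [hu i]
  · have := hdom i hi
    rcases eq_or_eq_neg_of_abs_eq (hs i) with h | h <;> rw [h] <;> constructor <;>
      linarith [hu i, hu k]

lemma mul_le_and_one_sub_le_of_sign_pos (hk : s k = 1) (i : ι) :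
    s i * (p - 1) * u i ≤ (p - 1) * u k ∧ 1 - (p - 1) * u k ≤ s i * u i := by
  have nonneg : 0 ≤ (p - 1) * u i := mul_nonneg (by linarith) (hu i).le
  have two_mul_le : 2 * u k ≤ (p - 1) * u k := mul_le_mul_of_nonneg_right (by linarith) (hu k).le
  obtain rfl | hi := eq_or_ne i k
  · rw [hk]
    constructor <;> linarith [hu i]
  · have := hdom i hi
    rcases eq_or_eq_neg_of_abs_eq (hs i) with h | h <;> rw [h] <;> constructor <;>
      linarith [hu i, hu k]

end DominantDeviation

lemma eq_zero_or_le_of_mem_table0 {p m ℓ : ℕ} {M : ℤ} (hM : 0 ≤ M)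
    (hdev : ∀ i : Fin 4, sgn m ℓ i * (p - 1) * p ^ (m / 2 + i * m.gcd ℓ - 1) ≤ M + 1 ∧
      -M ≤ sgn m ℓ i * p ^ (m / 2 + i * m.gcd ℓ - 1))
    {row : ℤ × ℚ} (hrow : row ∈ table0 p m ℓ) :
    row.1 = 0 ∨ p ^ m - p ^ (m - 1) - 1 - M ≤ row.1 := by
  have nonneg : (0 : ℤ) ≤ p ^ (m - 1) := by positivity
  simp only [table0, List.mem_append, List.mem_cons, List.mem_flatMap, List.mem_finRange, true_and,
    List.not_mem_nil, or_false] at hrow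
  rcases hrow with (rfl | rfl) | ⟨i, rfl | rfl⟩
  · exact .inl rfl
  all_goals right
  · linarith
  all_goals linarith [(hdev i).1, (hdev i).2]

lemma eq_zero_or_le_of_mem_table2 {p m ℓ : ℕ} {M : ℤ} (hM : 0 ≤ M)
    (hdev : ∀ i : Fin 4, sgn m ℓ i * (p - 1) * p ^ (m / 2 + i * m.gcd ℓ - 1) ≤ M ∧
      -M ≤ sgn m ℓ i * p ^ (m / 2 + i * m.gcd ℓ - 1))
    {row : ℤ × ℚ} (hrow : row ∈ table2 p m ℓ) :
    row.1 = 0 ∨ p ^ m - p ^ (m - 1) - 1 - M ≤ row.1 := by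
  have nonneg : (0 : ℤ) ≤ p ^ (m - 1) := by positivity
  simp only [table2, List.mem_append, List.mem_cons, List.mem_flatMap, List.mem_finRange, true_and,
    List.not_mem_nil, or_false] at hrow
  rcases hrow with (rfl | rfl | rfl | rfl) | ⟨i, rfl | rfl | rfl | rfl⟩
  · exact .inl rfl
  all_goals right
  iterate 3 linarith
  all_goals linarith [(hdev i).1, (hdev i).2]

section Deviations

variable {p n m ℓ : ℕ} (hδ : m.gcd ℓ ≠ 0) (hm : m = 2 * (n * m.gcd ℓ))
include hδ hm

omit hδ hm in
lemma abs_sgn (i : Fin 4) : |sgn m ℓ i| = 1 := by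
  rw [sgn, eps, abs_mul, abs_neg_one_pow, abs_neg_one_pow, one_mul]

lemma sgn_three_of_even (hn : Even n) : sgn m ℓ 3 = -1 := by
  rw [sgn, eps_eq hδ hm, hn.neg_one_pow]
  rfl

lemma sgn_three_of_not_even (hn : ¬Even n) : sgn m ℓ 3 = 1 := by
  rw [sgn, eps_eq hδ hm, (Nat.not_even_iff_odd.1 hn).neg_one_pow]
  rfl

variable (hp : 3 ≤ p)
include hp

omit hδ hm in
lemma two_mul_pow_three_le :
    (2 * p ^ (m / 2 + 3 * m.gcd ℓ - 1) : ℤ) ≤ (p - 1) * p ^ (m / 2 + 3 * m.gcd ℓ - 1) :=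
  mul_le_mul_of_nonneg_right (by lia) (by positivity)

omit hm in
lemma mul_pow_le_pow_three {i : Fin 4} (hi : i ≠ 3) :
    (p * p ^ (m / 2 + i * m.gcd ℓ - 1) : ℤ) ≤ p ^ (m / 2 + 3 * m.gcd ℓ - 1) := by
  have : (i + 1) * m.gcd ℓ ≤ 3 * m.gcd ℓ := by
    gcongr
    lia
  rw [← pow_succ']
  refine pow_le_pow_right₀ (by lia) ?_
  rw [add_one_mul] at this
  omega

variable (hn : 4 ≤ n)
include hn

lemma mul_pow_three_le_pow_pred :
    (p * p ^ (m / 2 + 3 * m.gcd ℓ - 1) : ℤ) ≤ p ^ (m - 1) := by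
  have := Nat.mul_le_mul_right (m.gcd ℓ) hn
  rw [← pow_succ']
  exact pow_le_pow_right₀ (by lia) (by omega)

lemma sub_one_mul_pow_three_lt :
    ((p - 1) * p ^ (m / 2 + 3 * m.gcd ℓ - 1) + 1 : ℤ) < p ^ m - p ^ (m - 1) := by
  have := mul_pow_three_le_pow_pred hδ hm hp hn
  have u_pos : (0 : ℤ) < p ^ (m / 2 + 3 * m.gcd ℓ - 1) := by positivity
  have : (3 * p ^ (m - 1) : ℤ) ≤ p * p ^ (m - 1) := by
    gcongr
    exact_mod_cast hp
  rw [← mul_pow_sub_one (exponent_ne_zero hδ hm hn)]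
  linarith [show (0 : ℤ) < p ^ (m - 1) by positivity]

lemma pow_half_lt_pow_rank :
    (p : ℚ) ^ (m / 2 - 3 * m.gcd ℓ - 1) < p ^ (m - 2 * 3 * m.gcd ℓ - 1) := by
  have := Nat.mul_le_mul_right (m.gcd ℓ) hn
  exact pow_lt_pow_right₀ (by norm_cast; lia) (by omega)

lemma pow_half_lt_pow_rank_sub :
    (p : ℚ) ^ (m / 2 - 3 * m.gcd ℓ - 1) <
      p ^ (m - 2 * 3 * m.gcd ℓ) - p ^ (m - 2 * 3 * m.gcd ℓ - 1) := by
  have two_mul_le : 2 * (p : ℚ) ^ (m - 2 * 3 * m.gcd ℓ - 1) ≤ p ^ (m - 2 * 3 * m.gcd ℓ) := by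
    rw [← mul_pow_sub_one (show m - 2 * 3 * m.gcd ℓ ≠ 0 from rank_ne_zero hδ hm hn 3)]
    gcongr
    norm_cast
    lia
  linarith [pow_half_lt_pow_rank hδ hm hp hn]

omit hn in
lemma deviation_bounds_of_even (hev : Even n) (i : Fin 4) :
    (sgn m ℓ i * (p - 1) * p ^ (m / 2 + i * m.gcd ℓ - 1) : ℤ) ≤ p ^ (m / 2 + 3 * m.gcd ℓ - 1) ∧
      (-p ^ (m / 2 + 3 * m.gcd ℓ - 1) : ℤ) ≤ sgn m ℓ i * p ^ (m / 2 + i * m.gcd ℓ - 1) :=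
  mul_le_and_neg_le_of_sign_neg (k := (3 : Fin 4))
    (u := fun i : Fin 4 => (p : ℤ) ^ (m / 2 + i * m.gcd ℓ - 1)) (by exact_mod_cast hp) abs_sgn
    (fun i => by positivity) (fun i => mul_pow_le_pow_three hδ hp)
    (sgn_three_of_even hδ hm hev) i

omit hn in
lemma deviation_bounds_of_not_even (hev : ¬Even n) (i : Fin 4) :
    (sgn m ℓ i * (p - 1) * p ^ (m / 2 + i * m.gcd ℓ - 1) : ℤ) ≤
        (p - 1) * p ^ (m / 2 + 3 * m.gcd ℓ - 1) ∧
      (1 - (p - 1) * p ^ (m / 2 + 3 * m.gcd ℓ - 1) : ℤ) ≤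
        sgn m ℓ i * p ^ (m / 2 + i * m.gcd ℓ - 1) :=
  mul_le_and_one_sub_le_of_sign_pos (k := (3 : Fin 4))
    (u := fun i : Fin 4 => (p : ℤ) ^ (m / 2 + i * m.gcd ℓ - 1)) (by exact_mod_cast hp) abs_sgn
    (fun i => by positivity) (fun i => mul_pow_le_pow_three hδ hp)
    (sgn_three_of_not_even hδ hm hev) i

end Deviations

section MinimumDistance

variable {F ι : Type*} [Field F] [DecidableEq F] [Fintype ι] {C : Submodule F (ι → F)}
  {p n m ℓ : ℕ} (hδ : m.gcd ℓ ≠ 0) (hm : m = 2 * (n * m.gcd ℓ)) (hp : 3 ≤ p) (hn : 4 ≤ n)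
  (hF : 0 < freq p m ℓ 3)
include hδ hm hp hn hF

lemma exists_isLeast_dist_of_table0_of_even (hT : HasWeightDistribution C (table0 p m ℓ))
    (hev : Even n) : ∃ d : ℕ,
      (d : ℤ) = p ^ (m - 1) * (p - 1) - (p ^ (m / 2 + 3 * m.gcd ℓ - 1) + 1) ∧
      IsLeast {e | ∃ c ∈ C, ∃ c' ∈ C, c ≠ c' ∧ hammingDist c c' = e} d := by
  have weight_lt := sub_one_mul_pow_three_lt hδ hm hp hn
  have u_pos : (0 : ℤ) < p ^ (m / 2 + 3 * m.gcd ℓ - 1) := by positivity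
  have u_le := two_mul_pow_three_le (m := m) (ℓ := ℓ) hp
  have weight_eq : (p ^ (m - 1) * (p - 1) - (p ^ (m / 2 + 3 * m.gcd ℓ - 1) + 1) : ℤ) =
      p ^ m - p ^ (m - 1) - 1 - p ^ (m / 2 + 3 * m.gcd ℓ - 1) := by
    linear_combination mul_pow_sub_one (exponent_ne_zero hδ hm hn) (p : ℤ)
  have row_mem : (_, (p - 1) * freq p m ℓ 3) ∈ table0 p m ℓ :=
    List.mem_append_right _ (List.mem_flatMap.2 ⟨3, List.mem_finRange 3, .tail _ (.head _)⟩)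
  rw [sgn_three_of_even hδ hm hev] at row_mem
  rw [weight_eq]
  refine exists_isLeast_dist hT row_mem ?_ (by linarith) ?_ fun _ =>
    eq_zero_or_le_of_mem_table0 u_pos.le fun i => ?_
  · simp only [Fin.coe_ofNat_eq_mod, Nat.reduceMod]
    ring
  · have : (1 : ℚ) < p := by norm_cast; lia
    exact (mul_pos (sub_pos.2 this) hF).ne'
  · have := deviation_bounds_of_even hδ hm hp hev i
    constructor <;> linarith

lemma exists_isLeast_dist_of_table0_of_not_even (hT : HasWeightDistribution C (table0 p m ℓ))
    (hev : ¬Even n) : ∃ d : ℕ,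
      (d : ℤ) = p ^ (m - 1) * (p - 1) - (p - 1) * p ^ (m / 2 + 3 * m.gcd ℓ - 1) ∧
      IsLeast {e | ∃ c ∈ C, ∃ c' ∈ C, c ≠ c' ∧ hammingDist c c' = e} d := by
  have weight_lt := sub_one_mul_pow_three_lt hδ hm hp hn
  have u_pos : (0 : ℤ) < p ^ (m / 2 + 3 * m.gcd ℓ - 1) := by positivity
  have u_le := two_mul_pow_three_le (m := m) (ℓ := ℓ) hp
  have weight_eq : (p ^ (m - 1) * (p - 1) - (p - 1) * p ^ (m / 2 + 3 * m.gcd ℓ - 1) : ℤ) =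
      p ^ m - p ^ (m - 1) - 1 - ((p - 1) * p ^ (m / 2 + 3 * m.gcd ℓ - 1) - 1) := by
    linear_combination mul_pow_sub_one (exponent_ne_zero hδ hm hn) (p : ℤ)
  have row_mem : (_, freq p m ℓ 3) ∈ table0 p m ℓ :=
    List.mem_append_right _ (List.mem_flatMap.2 ⟨3, List.mem_finRange 3, .head _⟩)
  rw [sgn_three_of_not_even hδ hm hev] at row_mem
  rw [weight_eq]
  refine exists_isLeast_dist hT row_mem ?_ (by linarith) hF.ne' fun _ =>
    eq_zero_or_le_of_mem_table0 (by linarith) fun i => ?_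
  · simp only [Fin.coe_ofNat_eq_mod, Nat.reduceMod]
    ring
  · have := deviation_bounds_of_not_even hδ hm hp hev i
    constructor <;> linarith

lemma exists_isLeast_dist_of_table2_of_even (hT : HasWeightDistribution C (table2 p m ℓ))
    (hev : Even n) : ∃ d : ℕ,
      (d : ℤ) = p ^ (m - 1) * (p - 1) - (p ^ (m / 2 + 3 * m.gcd ℓ - 1) + 1) ∧
      IsLeast {e | ∃ c ∈ C, ∃ c' ∈ C, c ≠ c' ∧ hammingDist c c' = e} d := by
  have weight_lt := sub_one_mul_pow_three_lt hδ hm hp hn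
  have u_pos : (0 : ℤ) < p ^ (m / 2 + 3 * m.gcd ℓ - 1) := by positivity
  have u_le := two_mul_pow_three_le (m := m) (ℓ := ℓ) hp
  have weight_eq : (p ^ (m - 1) * (p - 1) - (p ^ (m / 2 + 3 * m.gcd ℓ - 1) + 1) : ℤ) =
      p ^ m - p ^ (m - 1) - 1 - p ^ (m / 2 + 3 * m.gcd ℓ - 1) := by
    linear_combination mul_pow_sub_one (exponent_ne_zero hδ hm hn) (p : ℤ)
  have row_mem : (_, (p ^ (m - 2 * 3 * m.gcd ℓ) - p ^ (m - 2 * 3 * m.gcd ℓ - 1) +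
      sgn m ℓ 3 * p ^ (m / 2 - 3 * m.gcd ℓ - 1)) * (p - 1) * freq p m ℓ 3) ∈ table2 p m ℓ :=
    List.mem_append_right _ (List.mem_flatMap.2
      ⟨3, List.mem_finRange 3, .tail _ (.tail _ (.tail _ (.head _)))⟩)
  rw [sgn_three_of_even hδ hm hev] at row_mem
  rw [weight_eq]
  refine exists_isLeast_dist hT row_mem ?_ (by linarith) ?_ fun _ =>
    eq_zero_or_le_of_mem_table2 u_pos.le (deviation_bounds_of_even hδ hm hp hev)
  · simp only [Fin.coe_ofNat_eq_mod, Nat.reduceMod]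
    ring
  · have coefficient_pos := pow_half_lt_pow_rank_sub hδ hm hp hn
    have p_gt : (1 : ℚ) < p := by norm_cast; lia
    refine (mul_pos (mul_pos ?_ (sub_pos.2 p_gt)) hF).ne'
    push_cast
    linarith

lemma exists_isLeast_dist_of_table2_of_not_even (hT : HasWeightDistribution C (table2 p m ℓ))
    (hev : ¬Even n) : ∃ d : ℕ,
      (d : ℤ) = p ^ (m - 1) * (p - 1) - ((p - 1) * p ^ (m / 2 + 3 * m.gcd ℓ - 1) + 1) ∧
      IsLeast {e | ∃ c ∈ C, ∃ c' ∈ C, c ≠ c' ∧ hammingDist c c' = e} d := by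
  have weight_lt := sub_one_mul_pow_three_lt hδ hm hp hn
  have u_pos : (0 : ℤ) < p ^ (m / 2 + 3 * m.gcd ℓ - 1) := by positivity
  have u_le := two_mul_pow_three_le (m := m) (ℓ := ℓ) hp
  have weight_eq : (p ^ (m - 1) * (p - 1) - ((p - 1) * p ^ (m / 2 + 3 * m.gcd ℓ - 1) + 1) : ℤ) =
      p ^ m - p ^ (m - 1) - 1 - (p - 1) * p ^ (m / 2 + 3 * m.gcd ℓ - 1) := by
    linear_combination mul_pow_sub_one (exponent_ne_zero hδ hm hn) (p : ℤ)
  have row_mem : (_, (p ^ (m - 2 * 3 * m.gcd ℓ - 1) -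
      sgn m ℓ 3 * p ^ (m / 2 - 3 * m.gcd ℓ - 1)) * (p - 1) * freq p m ℓ 3) ∈ table2 p m ℓ :=
    List.mem_append_right _ (List.mem_flatMap.2
      ⟨3, List.mem_finRange 3, .tail _ (.tail _ (.head _))⟩)
  rw [sgn_three_of_not_even hδ hm hev] at row_mem
  rw [weight_eq]
  refine exists_isLeast_dist hT row_mem ?_ (by linarith) ?_ fun _ =>
    eq_zero_or_le_of_mem_table2 (by linarith) fun i => ?_
  · simp only [Fin.coe_ofNat_eq_mod, Nat.reduceMod]
    ring
  · have coefficient_pos := pow_half_lt_pow_rank hδ hm hp hn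
    have p_gt : (1 : ℚ) < p := by norm_cast; lia
    refine (mul_pos (mul_pos ?_ (sub_pos.2 p_gt)) hF).ne'
    push_cast
    linarith
  · have := deviation_bounds_of_not_even hδ hm hp hev i
    constructor <;> linarith

end MinimumDistance

section Parameters

variable {p : ℕ} [Fact p.Prime] [Invertible (2 : ZMod p)] {K : Type*} [Field K] [Fintype K]
  [DecidableEq K] [Algebra (ZMod p) K] {σ : K ≃ₐ[ZMod p] K} {n m ℓ : ℕ}

omit [Invertible (2 : ZMod p)] [DecidableEq K] in
lemma finrank_eq_of_card (hK : Fintype.card K = p ^ m) : Module.finrank (ZMod p) K = m := by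
  rw [Module.card_eq_pow_finrank (K := ZMod p), ZMod.card] at hK
  exact Nat.pow_right_injective (Fact.out : p.Prime).two_le hK

variable (h : IsHermitianFrobenius σ (p ^ m.gcd ℓ)) (hK : Fintype.card K = p ^ m)
  (hδ : m.gcd ℓ ≠ 0) (hm : m = 2 * (n * m.gcd ℓ)) (hn : 4 ≤ n)
include h hK hδ hm hn

lemma freq_three_pos : 0 < freq p m ℓ 3 := by
  have hq := h.two_le
  rw [← corankCount_eq_freq h hK hδ hm hn 3]
  refine (solvesMoments_corankCount h (hK.trans (pow_eq_pow_gcd_pow p hm)) hn).three_pos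
    (by exact_mod_cast hq) ?_
  rw [abs_mul, abs_neg_one_pow, one_mul, abs_of_nonneg (by positivity)]
  exact_mod_cast Nat.pow_lt_pow_right hq (by lia : 2 < n)

lemma finrank_range_quadraticFamily :
    Module.finrank (ZMod p) (LinearMap.range (unitWord (quadraticFamily σ))) = 2 * m + 1 := by
  have injective := unitWord_quadraticFamily_injective h (hK.trans (pow_eq_pow_gcd_pow p hm))
    ((ZMod.card p).dvd.trans (dvd_pow_self p hδ)) hn
  have := Module.finite_of_finite (ZMod p) (M := K)
  rw [LinearMap.finrank_range_of_inj injective, Module.finrank_prod, Module.finrank_prod,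
    Module.finrank_self, finrank_eq_of_card hK, two_mul]

lemma finrank_range_polynomialFamily :
    Module.finrank (ZMod p) (LinearMap.range (unitWord (polynomialFamily σ))) = 3 * m + 1 := by
  have injective := unitWord_polynomialFamily_injective h (hK.trans (pow_eq_pow_gcd_pow p hm))
    ((ZMod.card p).dvd.trans (dvd_pow_self p hδ)) hn
  have := Module.finite_of_finite (ZMod p) (M := K)
  rw [LinearMap.finrank_range_of_inj injective, Module.finrank_prod, Module.finrank_prod,
    Module.finrank_prod, Module.finrank_self, Subspace.dual_finrank_eq, finrank_eq_of_card hK]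
  ring

lemma exists_isCode_quadraticFamily : ∃ d : ℕ,
    (d : ℤ) = p ^ (m - 1) * (p - 1) - (if Even n then (p : ℤ) ^ (m / 2 + 3 * m.gcd ℓ - 1) + 1
      else (p - 1) * p ^ (m / 2 + 3 * m.gcd ℓ - 1)) ∧
    IsCode (LinearMap.range (unitWord (quadraticFamily σ))) (p ^ m - 1) (2 * m + 1) d := by
  have hp : 3 ≤ p := (three_le_card (ZMod p)).trans_eq (ZMod.card p)
  have hF := freq_three_pos h hK hδ hm hn
  have hT := hasWeightDistribution_quadraticFamily h hK hδ hm hn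
  have length_eq := hK ▸ Fintype.card_units (α := K)
  have finrank_eq := finrank_range_quadraticFamily h hK hδ hm hn
  split_ifs with hev
  · exact (exists_isLeast_dist_of_table0_of_even hδ hm hp hn hF hT hev).imp
      fun _ hd => ⟨hd.1, length_eq, finrank_eq, hd.2⟩
  · exact (exists_isLeast_dist_of_table0_of_not_even hδ hm hp hn hF hT hev).imp
      fun _ hd => ⟨hd.1, length_eq, finrank_eq, hd.2⟩

lemma exists_isCode_polynomialFamily : ∃ d : ℕ,
    (d : ℤ) = p ^ (m - 1) * (p - 1) - (if Even n then (p : ℤ) ^ (m / 2 + 3 * m.gcd ℓ - 1) + 1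
      else (p - 1) * p ^ (m / 2 + 3 * m.gcd ℓ - 1) + 1) ∧
    IsCode (LinearMap.range (unitWord (polynomialFamily σ))) (p ^ m - 1) (3 * m + 1) d := by
  have hp : 3 ≤ p := (three_le_card (ZMod p)).trans_eq (ZMod.card p)
  have hF := freq_three_pos h hK hδ hm hn
  have hT := hasWeightDistribution_polynomialFamily h hK hδ hm hn
  have length_eq := hK ▸ Fintype.card_units (α := K)
  have finrank_eq := finrank_range_polynomialFamily h hK hδ hm hn
  split_ifs with hev
  · exact (exists_isLeast_dist_of_table2_of_even hδ hm hp hn hF hT hev).imp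
      fun _ hd => ⟨hd.1, length_eq, finrank_eq, hd.2⟩
  · exact (exists_isLeast_dist_of_table2_of_not_even hδ hm hp hn hF hT hev).imp
      fun _ hd => ⟨hd.1, length_eq, finrank_eq, hd.2⟩

end Parameters

end TraceCode

theorem theorem5p2_general (p m ℓ : ℕ) [Fact p.Prime] (hp : p ≠ 2)
    (hEven : Even (m / m.gcd ℓ)) (hmℓ : 6 * m.gcd ℓ < m)
    (K : Type*) [Field K] [Fintype K] [DecidableEq K] [Algebra (ZMod p) K]
    (hK : Fintype.card K = p ^ m) :
    (∃ d dhat : ℕ,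
      (d : ℤ) = (p : ℤ) ^ (m - 1) * ((p : ℤ) - 1)
        - (if Even (m / m.gcd ℓ / 2) then (p : ℤ) ^ (m / 2 + 3 * m.gcd ℓ - 1) + 1
            else ((p : ℤ) - 1) * (p : ℤ) ^ (m / 2 + 3 * m.gcd ℓ - 1)) ∧
      (dhat : ℤ) = (if Even (m / m.gcd ℓ / 2) then (d : ℤ) else (d : ℤ) - 1) ∧
      TraceCode.IsCode (TraceCode.code0 p (TraceCode.linFamily p K ℓ)) (p ^ m - 1) (2 * m + 1) d ∧
      TraceCode.IsCode (TraceCode.code2 p (TraceCode.linFamily p K ℓ))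
        (p ^ m - 1) (3 * m + 1) dhat) ∧
    TraceCode.HasWeightDistribution (TraceCode.code0 p (TraceCode.linFamily p K ℓ))
      (TraceCode.table0 p m ℓ) ∧
    TraceCode.HasWeightDistribution (TraceCode.code2 p (TraceCode.linFamily p K ℓ))
      (TraceCode.table2 p m ℓ) := by
  open TraceCode in
  obtain ⟨n, hn⟩ := hEven
  rw [← two_mul] at hn
  have hm : m = 2 * (n * m.gcd ℓ) := by
    rw [← mul_assoc, ← hn, Nat.div_mul_cancel (Nat.gcd_dvd_left m ℓ)]
  have hδ : m.gcd ℓ ≠ 0 := fun h => by simp [Nat.eq_zero_of_gcd_eq_zero_left h] at hmℓ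
  have four_le : 4 ≤ n := by
    have : 3 * m.gcd ℓ < n * m.gcd ℓ := by omega
    exact Nat.lt_of_mul_lt_mul_right this
  have two_ne : (2 : ZMod p) ≠ 0 := Ring.two_ne_zero (by rwa [ZMod.ringChar_zmod_n])
  let _ := invertibleOfNonzero two_ne
  obtain ⟨σ, hσ⟩ := exists_frobenius_pow p K ℓ
  have h := isHermitianFrobenius hσ hK hδ hm
  rw [hn, Nat.mul_div_cancel_left n two_pos, code0_eq_range hσ, code2_eq_range hσ]
  refine ⟨?_, hasWeightDistribution_quadraticFamily h hK hδ hm four_le,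
    hasWeightDistribution_polynomialFamily h hK hδ hm four_le⟩
  obtain ⟨d, hd, isCode0⟩ := exists_isCode_quadraticFamily h hK hδ hm four_le
  obtain ⟨dhat, hdhat, isCode2⟩ := exists_isCode_polynomialFamily h hK hδ hm four_le
  refine ⟨d, dhat, hd, ?_, isCode0, isCode2⟩
  rw [hdhat, hd]
  split_ifs <;> ring

theorem theorem5p2 (p m ℓ : ℕ) [Fact p.Prime] (hp : p ≠ 2) (hm : 0 < m) (hℓ : 0 < ℓ)
    (hEven : Even (m / m.gcd ℓ)) (hmℓ : 6 * ℓ < m)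
    (K : Type*) [Field K] [Fintype K] [DecidableEq K] [Algebra (ZMod p) K]
    (hK : Fintype.card K = p ^ m) :
    (∃ d dhat : ℕ,
      (d : ℤ) = (p : ℤ) ^ (m - 1) * ((p : ℤ) - 1)
        - (if Even (m / m.gcd ℓ / 2) then (p : ℤ) ^ (m / 2 + 3 * m.gcd ℓ - 1) + 1
            else ((p : ℤ) - 1) * (p : ℤ) ^ (m / 2 + 3 * m.gcd ℓ - 1)) ∧
      (dhat : ℤ) = (if Even (m / m.gcd ℓ / 2) then (d : ℤ) else (d : ℤ) - 1) ∧
      TraceCode.IsCode (TraceCode.code0 p (TraceCode.linFamily p K ℓ)) (p ^ m - 1) (2 * m + 1) d ∧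
      TraceCode.IsCode (TraceCode.code2 p (TraceCode.linFamily p K ℓ))
        (p ^ m - 1) (3 * m + 1) dhat) ∧
    TraceCode.HasWeightDistribution (TraceCode.code0 p (TraceCode.linFamily p K ℓ))
      (TraceCode.table0 p m ℓ) ∧
    TraceCode.HasWeightDistribution (TraceCode.code2 p (TraceCode.linFamily p K ℓ))
      (TraceCode.table2 p m ℓ) :=
  theorem5p2_general p m ℓ hp hEven
    ((Nat.mul_le_mul_left 6 (Nat.gcd_le_right _ hℓ)).trans_lt hmℓ) K hK
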